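/- Let $d\ge 1$, let $T>0$ and let $\Omega\subseteq\mathbb{R}^d$ be an open set with uniformly Lipschitz boundary, i.e. there are $\varepsilon,L>0$, $M\in\mathbb{N}$ and a countable locally finite family of open sets $U_n$ covering $\partial\Omega$ such that every ball $B(x,\varepsilon)$ with $x\in\partial\Omega$ is contained in some $U_n$, no point of $\mathbb{R}^d$ belongs to more than $M$ of the $U_n$, and for each $n$ there are Cartesian coordinates $y=(y',y_d)$ and a function $f_n:\mathbb{R}^{d-1}\to\mathbb{R}$ with Lipschitz constant at most $L$ such that $U_n\cap\Omega=U_n\cap\{y_d>f_n(y')\}$. Write $L^\infty(]0,T[\times\partial\Omega)$ for $L^\infty$ with respect to $\mathscr{L}^1\otimes\mathscr{H}^{d-1}$; $\nabla$ and $\operatorname{div}$ act on the variable $x$ only. Let $C^\infty_c([0,T[\times\mathbb{R}^d)$ be the set of restrictions to $[0,T[\times\mathbb{R}^d$ of functions in $C^\infty_c(]-\infty,T[\times\mathbb{R}^d)$. Let $b\in L^\infty(]0,T[\times\Omega;\mathbb{R}^d)$ be a vector field whose distributional divergence $\operatorname{div} b$ is a locally finite (signed) Radon measure on $]0,T[\times\Omega$.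 (1) Suppose that $\operatorname{div} b$ is locally finite up to the boundary, i.e. its total variation is finite on $K\cap(]0,T[\times\Omega)$ for every compact $K\subseteq[0,T[\times\overline\Omega$. Then there is a unique $\mathrm{Tr}\,b\in L^\infty(]0,T[\times\partial\Omega)$ such that for all $\varphi\in C^\infty_c([0,T[\times\mathbb{R}^d)$ $$\int_0^T\!\!\int_{\partial\Omega}\mathrm{Tr}\,b\;\varphi\,d\mathscr{H}^{d-1}dt-\int_\Omega\varphi(0,x)\,dx=\int_0^T\!\!\int_\Omega(\partial_t\varphi+b\cdot\nabla\varphi)\,dx\,dt+\int_{]0,T[\times\Omega}\varphi\,d(\operatorname{div} b).$$ (2) Let $w,f\in L^\infty(]0,T[\times\Omega)$ satisfy $\partial_t w+\operatorname{div}(bw)=f$ in the sense of distributions, i.e. for all $\eta\in C_c^\infty(]0,T[\times\Omega)$ $$\int_0^T\!\!\int_\Omega w(\partial_t\eta+b\cdot\nabla\eta)\,dx\,dt+\int_0^T\!\!\int_\Omega f\eta\,dx\,dt=0 .$$ Then there is a unique pair of functions $\mathrm{Tr}(bw)\in L^\infty(]0,T[\times\partial\Omega)$ and $w_0\in L^\infty(\Omega)$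 such that for all $\varphi\in C^\infty_c([0,T[\times\mathbb{R}^d)$ $$\int_0^T\!\!\int_{\partial\Omega}\mathrm{Tr}(bw)\,\varphi\,d\mathscr{H}^{d-1}dt-\int_\Omega\varphi(0,x)\,w_0\,dx=\int_0^T\!\!\int_\Omega w(\partial_t\varphi+b\cdot\nabla\varphi)\,dx\,dt+\int_0^T\!\!\int_\Omega f\varphi\,dx\,dt.$$ -/

import Mathlib

open MeasureTheory Set Metric
open scoped ENNReal

/-- The open set `Ω ⊆ ℝᵈ` has uniformly Lipschitz boundary (Leoni): there are `ε, L > 0`, `M ∈ ℕ`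
and a countable locally finite family of open sets `U n` covering `∂Ω` such that
every ball `B(x, ε)` centred at `x ∈ ∂Ω` lies in one of the `U n`, no point lies in more than `M`
of the `U n`, and inside each `U n`, in suitable Cartesian coordinates `y = (y', y_d)` (the isometry
`e`), `Ω` is the open region above the graph of an `L`-Lipschitz function `f : ℝᵈ⁻¹ → ℝ`. -/
def HasUniformlyLipschitzBoundary {d : ℕ} (Ω : Set (EuclideanSpace ℝ (Fin d))) : Prop :=
  ∃ (ε : ℝ) (L : NNReal) (M : ℕ) (U : ℕ → Set (EuclideanSpace ℝ (Fin d))),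
    0 < ε ∧ 0 < L ∧
    (∀ n, IsOpen (U n)) ∧ LocallyFinite U ∧ frontier Ω ⊆ ⋃ n, U n ∧
    (∀ x ∈ frontier Ω, ∃ n, ball x ε ⊆ U n) ∧
    (∀ x, {n | x ∈ U n}.encard ≤ M) ∧
    ∀ n, ∃ (e : EuclideanSpace ℝ (Fin d) ≃ᵃⁱ[ℝ]
              WithLp 2 (EuclideanSpace ℝ (Fin (d - 1)) × ℝ))
          (f : EuclideanSpace ℝ (Fin (d - 1)) → ℝ),
      LipschitzWith L f ∧ U n ∩ Ω = U n ∩ {x | f (e x).fst < (e x).snd}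

/-- The open space-time cylinder `]0, T[ × Ω`. -/
def spaceTimeCylinder {d : ℕ} (T : ℝ) (Ω : Set (EuclideanSpace ℝ (Fin d))) :
    Set (ℝ × EuclideanSpace ℝ (Fin d)) :=
  Ioo 0 T ×ˢ Ω

/-- The measure `ℒ¹ ⊗ ℋᵈ⁻¹` on `]0, T[ × ∂Ω`, with the Hausdorff measure in its usual
normalization. -/
noncomputable def lateralMeasure {d : ℕ} (T : ℝ) (Ω : Set (EuclideanSpace ℝ (Fin d))) :
    Measure (ℝ × EuclideanSpace ℝ (Fin d)) :=
  (volume.restrict (Ioo 0 T)).prod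
    ((Measure.euclideanHausdorffMeasure (d - 1)).restrict (frontier Ω))

/-- `∂ₜ φ` at the point `z = (t, x)`. -/
noncomputable def timeDeriv {d : ℕ} (φ : ℝ × EuclideanSpace ℝ (Fin d) → ℝ)
    (z : ℝ × EuclideanSpace ℝ (Fin d)) : ℝ :=
  fderiv ℝ φ z (1, 0)

/-- `v · ∇ φ` at the point `z = (t, x)`, the gradient being taken in the variable `x` only. -/
noncomputable def spaceDeriv {d : ℕ} (φ : ℝ × EuclideanSpace ℝ (Fin d) → ℝ)
    (z : ℝ × EuclideanSpace ℝ (Fin d)) (v : EuclideanSpace ℝ (Fin d)) : ℝ :=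
  fderiv ℝ φ z (0, v)

/-- `η ∈ C_c^∞(V)`, for `V` open in `ℝ × ℝᵈ`, extended by zero. -/
def IsTestFunction {d : ℕ} (V : Set (ℝ × EuclideanSpace ℝ (Fin d)))
    (η : ℝ × EuclideanSpace ℝ (Fin d) → ℝ) : Prop :=
  ContDiff ℝ (⊤ : ℕ∞) η ∧ HasCompactSupport η ∧ tsupport η ⊆ V

/-- `φ ∈ C_c^∞([0, T[ × ℝᵈ)`: smooth up to `t = 0`, possibly nonzero there, and vanishing near
`t = T` and for large `|x|`. Such functions are the restrictions to `t ≥ 0` of the elements of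
`C_c^∞(]-∞, T[ × ℝᵈ)`, and only their values for `0 ≤ t < T` are ever used. -/
def IsTestFunctionUpToZero {d : ℕ} (T : ℝ) (φ : ℝ × EuclideanSpace ℝ (Fin d) → ℝ) : Prop :=
  IsTestFunction (Iio T ×ˢ univ) φ

/-- The measure `μ` is finite on the compact subsets of the set `V`. -/
def FiniteOnCompactsIn {X : Type*} [TopologicalSpace X] [MeasurableSpace X]
    (μ : Measure X) (V : Set X) : Prop :=
  ∀ K, IsCompact K → K ⊆ V → μ K < ∞

/-- The distributional divergence `div b`, in the variable `x` only, of the field `b` on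
`]0, T[ × Ω` is the locally finite signed Radon measure `μ⁺ - μ⁻` on `]0, T[ × Ω`. A locally finite
signed measure is given as a difference of two nonnegative ones, finite on compact subsets
of `]0, T[ × Ω`; their values outside `]0, T[ × Ω` play no role. -/
def HasSpaceDivergence {d : ℕ} (T : ℝ) (Ω : Set (EuclideanSpace ℝ (Fin d)))
    (b : ℝ × EuclideanSpace ℝ (Fin d) → EuclideanSpace ℝ (Fin d))
    (μp μn : Measure (ℝ × EuclideanSpace ℝ (Fin d))) : Prop :=
  FiniteOnCompactsIn μp (spaceTimeCylinder T Ω) ∧ FiniteOnCompactsIn μn (spaceTimeCylinder T Ω) ∧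
  ∀ η, IsTestFunction (spaceTimeCylinder T Ω) η →
    - ∫ z in spaceTimeCylinder T Ω, spaceDeriv η z (b z) =
      (∫ z in spaceTimeCylinder T Ω, η z ∂μp) - ∫ z in spaceTimeCylinder T Ω, η z ∂μn

/-- The measure `μ` on `]0, T[ × Ω` is locally finite in `[0, T[ × closure Ω`, i.e. up to
`t = 0` and up to `∂Ω`. -/
def LocallyFiniteUpToBoundary {d : ℕ} (T : ℝ) (Ω : Set (EuclideanSpace ℝ (Fin d)))
    (μ : Measure (ℝ × EuclideanSpace ℝ (Fin d))) : Prop :=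
  FiniteOnCompactsIn (μ.restrict (spaceTimeCylinder T Ω)) (Ico 0 T ×ˢ closure Ω)

/-- `∂ₜ w + div (b w) = f` in the sense of distributions on `]0, T[ × Ω`. -/
def IsDistributionalSolution {d : ℕ} (T : ℝ) (Ω : Set (EuclideanSpace ℝ (Fin d)))
    (b : ℝ × EuclideanSpace ℝ (Fin d) → EuclideanSpace ℝ (Fin d))
    (w f : ℝ × EuclideanSpace ℝ (Fin d) → ℝ) : Prop :=
  ∀ η, IsTestFunction (spaceTimeCylinder T Ω) η →
    (∫ z in spaceTimeCylinder T Ω, w z * (timeDeriv η z + spaceDeriv η z (b z)))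
      + ∫ z in spaceTimeCylinder T Ω, f z * η z = 0

open Filter Topology

/-!
Both parts concern a bounded space-time field `B` on `]0, T[ × Ω` whose space-time divergence is a
measure: `B = (0, b)` in (1) and `B = (w, w b)` in (2). Its flux pairing with `φ` is
`∫ B · ∇φ + ∫ φ d(div B)`, and it vanishes on test functions supported in `]0, T[ × Ω`. Multiply a
general `φ` by smooth cutoffs `κ_δ` which vanish near `t = 0` and near `∂Ω`. As `δ → 0`, the flux
pairing of `φ` turns out to be the limit of `-∫ φ ∇κ_δ · B`, which is bounded by `‖B‖_∞ / δ` times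
the integral of `|φ|` over the boundary layers of width `δ`. In Lipschitz charts these layer
integrals, divided by `δ`, are asymptotically at most a constant times the `L¹` norm of `φ` on
`]0, T[ × ∂Ω` and on `{0} × Ω`. By Hahn–Banach and the duality `(L¹)* = L^∞` the flux pairing is
therefore given by an `L^∞` density on these two pieces of the boundary, which is the sought trace.
-/

section DualOfLOne

variable {α : Type*} [MeasurableSpace α]

theorem exists_integrable_apply_indicatorConstLp_eq (μ : Measure α) [IsFiniteMeasure μ]
    (F : Lp ℝ 1 μ →L[ℝ] ℝ) :
    ∃ g : α → ℝ, Integrable g μ ∧ ∀ (s : Set α) (hs : MeasurableSet s) (c : ℝ),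
      F (indicatorConstLp 1 hs (measure_ne_top μ s) c) = c * ∫ x in s, g x ∂μ := by
  let one : Lp ℝ 2 μ := (memLp_const (1 : ℝ)).toLp _
  -- The inclusion of `L²` into `L¹`, as multiplication by the constant `1 ∈ L²`.
  let J : Lp ℝ 2 μ →L[ℝ] Lp ℝ 1 μ := (ContinuousLinearMap.mul ℝ ℝ).holderL μ 2 2 1 one
  have hJ : ∀ (s : Set α) (hs : MeasurableSet s) (c : ℝ),
      J (indicatorConstLp 2 hs (measure_ne_top μ s) c)
        = indicatorConstLp 1 hs (measure_ne_top μ s) c := fun s hs c => by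
    ext1
    filter_upwards [(ContinuousLinearMap.mul ℝ ℝ).coeFn_holder (r := 1) one
        (indicatorConstLp 2 hs (measure_ne_top μ s) c), (memLp_const (1 : ℝ)).coeFn_toLp (p := 2),
      indicatorConstLp_coeFn (p := 2) (hs := hs) (hμs := measure_ne_top μ s) (c := c),
      indicatorConstLp_coeFn (p := 1) (hs := hs) (hμs := measure_ne_top μ s) (c := c)]
      with x hmul hone h2 h1
    simp only [J, ContinuousLinearMap.holderL_apply_apply, hmul, one, hone, h2, h1,
      ContinuousLinearMap.mul_apply', one_mul]
  let g : Lp ℝ 2 μ := (InnerProductSpace.toDual ℝ (Lp ℝ 2 μ)).symm (F.comp J)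
  refine ⟨g, (Lp.memLp g).integrable one_le_two, fun s hs c => ?_⟩
  calc F (indicatorConstLp 1 hs (measure_ne_top μ s) c)
      = inner ℝ g (indicatorConstLp 2 hs (measure_ne_top μ s) c) := by
        rw [InnerProductSpace.toDual_symm_apply, ContinuousLinearMap.comp_apply, hJ]
    _ = c * ∫ x in s, g x ∂μ := by
        rw [real_inner_comm, L2.inner_indicatorConstLp_eq_inner_setIntegral]
        simp [mul_comm]

theorem ae_norm_le_of_forall_abs_setIntegral_le {μ : Measure α} [IsFiniteMeasure μ] {g : α → ℝ}
    (hg : Integrable g μ) {C : ℝ}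
    (h : ∀ s, MeasurableSet s → |∫ x in s, g x ∂μ| ≤ C * μ.real s) : ∀ᵐ x ∂μ, ‖g x‖ ≤ C := by
  have hupper : ∀ᵐ x ∂μ, g x ≤ C :=
    ae_le_of_forall_setIntegral_le hg (integrable_const _) fun s hs _ => by
      rw [setIntegral_const, smul_eq_mul, mul_comm]
      exact (le_abs_self _).trans (h s hs)
  have hlower : ∀ᵐ x ∂μ, -C ≤ g x :=
    ae_le_of_forall_setIntegral_le (integrable_const _) hg fun s hs _ => by
      rw [setIntegral_const, smul_eq_mul, mul_comm, neg_mul]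
      exact neg_le_of_abs_le (h s hs)
  filter_upwards [hupper, hlower] with x hu hl using abs_le.2 ⟨hl, hu⟩

theorem exists_Lp_top_apply_eq_integral_of_isFiniteMeasure (μ : Measure α) [IsFiniteMeasure μ]
    (F : Lp ℝ 1 μ →L[ℝ] ℝ) : ∃ G : Lp ℝ ∞ μ, ∀ u : Lp ℝ 1 μ, F u = ∫ x, G x * u x ∂μ := by
  obtain ⟨g, hg, hF⟩ := exists_integrable_apply_indicatorConstLp_eq μ F
  have hbound : ∀ᵐ x ∂μ, ‖g x‖ ≤ ‖F‖ :=
    ae_norm_le_of_forall_abs_setIntegral_le hg fun s hs => by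
      simpa [hF, norm_indicatorConstLp one_ne_zero ENNReal.one_ne_top]
        using F.le_opNorm (indicatorConstLp 1 hs (measure_ne_top μ s) 1)
  have hmem : MemLp g ∞ μ := memLp_top_of_bound hg.1 _ hbound
  let Φ : Lp ℝ 1 μ →L[ℝ] ℝ := (ContinuousLinearMap.mul ℝ ℝ).lpPairing μ ∞ 1 (hmem.toLp g)
  have hΦ : ∀ u, Φ u = ∫ x, hmem.toLp g x * u x ∂μ :=
    (ContinuousLinearMap.mul ℝ ℝ).lpPairing_eq_integral _
  refine ⟨hmem.toLp g, fun u => (?_ : F u = Φ u).trans (hΦ u)⟩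
  refine Lp.induction ENNReal.one_ne_top (motive := fun u => F u = Φ u) (fun c s hs _ => ?_)
    (fun v w _ _ _ hv hw => by rw [map_add, map_add, hv, hw])
    (isClosed_eq F.continuous Φ.continuous) u
  rw [Lp.simpleFunc.coe_indicatorConst, hF, hΦ, mul_comm, ← integral_mul_const,
    ← integral_indicator hs]
  refine integral_congr_ae ?_
  filter_upwards [hmem.coeFn_toLp,
    indicatorConstLp_coeFn (p := 1) (hs := hs) (hμs := measure_ne_top μ s) (c := c)] with x hx h1
  by_cases hxs : x ∈ s <;> simp [hx, h1, hxs]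

/-- The finite case applies to the measure `ρ ν`, for a positive `ν`-integrable weight `ρ`:
multiplication by `ρ` identifies `L¹(ρ ν)` with `L¹(ν)`. -/
theorem exists_Lp_top_apply_eq_integral (ν : Measure α) [SigmaFinite ν] (F : Lp ℝ 1 ν →L[ℝ] ℝ) :
    ∃ G : Lp ℝ ∞ ν, ∀ u : Lp ℝ 1 ν, F u = ∫ x, G x * u x ∂ν := by
  obtain ⟨ρ, hρpos, hρ, hρint⟩ := exists_pos_lintegral_lt_of_sigmaFinite ν (ε := 1) one_ne_zero
  let νρ : Measure α := ν.withDensity fun x => ρ x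
  have : IsFiniteMeasure νρ := isFiniteMeasure_withDensity (hρint.trans ENNReal.one_lt_top).ne
  have hac : ν ≪ νρ := withDensity_absolutelyContinuous' hρ.coe_nnreal_ennreal.aemeasurable
    (.of_forall fun x => ENNReal.coe_ne_zero.2 (hρpos x).ne')
  have hcancel : ∀ (x : α) (a : ℝ), ρ x • ((ρ x : ℝ)⁻¹ * a) = a := fun x a => by
    rw [NNReal.smul_def, smul_eq_mul, mul_inv_cancel_left₀ (NNReal.coe_ne_zero.2 (hρpos x).ne')]
  let S : Lp ℝ 1 νρ →ₗᵢ[ℝ] Lp ℝ 1 ν := withDensitySMulLI ν hρ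
  obtain ⟨G, hG⟩ :=
    exists_Lp_top_apply_eq_integral_of_isFiniteMeasure νρ (F.comp S.toContinuousLinearMap)
  have hGmem : MemLp G ∞ ν := ⟨(Lp.memLp G).1.mono_ac hac,
    (eLpNormEssSup_mono_measure _ hac).trans_lt (Lp.memLp G).2⟩
  refine ⟨hGmem.toLp G, fun u => ?_⟩
  have hv : Integrable (fun x => (ρ x : ℝ)⁻¹ * u x) νρ := by
    simpa only [νρ, integrable_withDensity_iff_integrable_smul hρ, hcancel]
      using L1.integrable_coeFn u
  have hSv : S (hv.toL1 _) = u := by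
    ext1
    refine (MemLp.coeFn_toLp (memL1_smul_of_L1_withDensity hρ (hv.toL1 _))).trans ?_
    filter_upwards [hac.ae_eq hv.coeFn_toL1] with x hx
    rw [hx, hcancel]
  calc F u = F.comp S.toContinuousLinearMap (hv.toL1 _) := by
        rw [ContinuousLinearMap.comp_apply, LinearIsometry.coe_toContinuousLinearMap, hSv]
    _ = ∫ x, ρ x • (G x * hv.toL1 _ x) ∂ν := by
        rw [hG, integral_withDensity_eq_integral_smul hρ]
    _ = ∫ x, hGmem.toLp G x * u x ∂ν := by
        refine integral_congr_ae ?_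
        filter_upwards [hac.ae_eq hv.coeFn_toL1, hGmem.coeFn_toLp] with x hx hGx
        rw [hx, hGx, ← mul_smul_comm, hcancel]

theorem exists_Lp_top_apply_eq_integral_of_le {V : Type*} [AddCommGroup V] [Module ℝ V]
    (ν : Measure α) [SigmaFinite ν] (ι : V →ₗ[ℝ] Lp ℝ 1 ν) (Λ : V →ₗ[ℝ] ℝ) (C : ℝ)
    (h : ∀ v, |Λ v| ≤ C * ‖ι v‖) : ∃ G : Lp ℝ ∞ ν, ∀ v, Λ v = ∫ x, G x * ι v x ∂ν := by
  have hker : Λ ∈ (LinearMap.ker ι).dualAnnihilator :=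
    (Submodule.mem_dualAnnihilator _).2 fun v hv => by simpa [LinearMap.mem_ker.1 hv] using h v
  obtain ⟨Λ', rfl⟩ : ∃ Λ' : Lp ℝ 1 ν →ₗ[ℝ] ℝ, Λ' ∘ₗ ι = Λ := by
    rwa [← LinearMap.range_dualMap_eq_dualAnnihilator_ker] at hker
  obtain ⟨F, hF, -⟩ := exists_extension_norm_eq (LinearMap.range ι) <|
    (Λ'.domRestrict (LinearMap.range ι)).mkContinuous C fun ⟨_, v, hv⟩ => by subst hv; exact h v
  obtain ⟨G, hG⟩ := exists_Lp_top_apply_eq_integral ν F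
  exact ⟨G, fun v => (hF (ι.rangeRestrict v)).symm.trans (hG _)⟩

end DualOfLOne

section UpperDini

/-- The upper right Dini derivative at `0` of a function `m` vanishing at `0`. It measures the
asymptotic density of a family of layers of width `δ → 0` and mass `m δ`. -/
noncomputable def upperDini (m : ℝ → ℝ≥0∞) : ℝ≥0∞ :=
  limsup (fun δ => m δ / ENNReal.ofReal δ) (𝓝[>] 0)

variable {m m' : ℝ → ℝ≥0∞}

theorem upperDini_mono (h : ∀ᶠ δ in 𝓝[>] 0, m δ ≤ m' δ) : upperDini m ≤ upperDini m' :=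
  limsup_le_limsup (h.mono fun _ hδ => ENNReal.div_le_div_right hδ _)

theorem upperDini_le_of_forall_eventually_le {I : ℝ≥0∞}
    (h : ∀ η : ℝ≥0∞, η ≠ 0 → ∀ᶠ δ in 𝓝[>] 0, m δ ≤ ENNReal.ofReal δ * (I + η)) :
    upperDini m ≤ I := by
  refine ENNReal.le_of_forall_pos_le_add fun η hη _ => limsup_le_of_le (h := ?_)
  filter_upwards [h η (ENNReal.coe_ne_zero.2 hη.ne')] with δ hδ
  exact ENNReal.div_le_of_le_mul' hδ

theorem upperDini_add_le : upperDini (fun δ => m δ + m' δ) ≤ upperDini m + upperDini m' := by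
  refine ENNReal.le_of_forall_pos_le_add fun η hη hfin => limsup_le_of_le (h := ?_)
  obtain ⟨hm, hm'⟩ := ENNReal.add_lt_top.1 hfin
  have hη2 : ((η / 2 : NNReal) : ℝ≥0∞) ≠ 0 := ENNReal.coe_ne_zero.2 (half_pos hη).ne'
  filter_upwards [eventually_lt_of_limsup_lt (ENNReal.lt_add_right hm.ne hη2),
    eventually_lt_of_limsup_lt (ENNReal.lt_add_right hm'.ne hη2)] with δ hδ hδ'
  calc (m δ + m' δ) / ENNReal.ofReal δ
      ≤ (upperDini m + (η / 2 : NNReal)) + (upperDini m' + (η / 2 : NNReal)) := by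
        rw [ENNReal.add_div]
        exact add_le_add hδ.le hδ'.le
    _ = upperDini m + upperDini m' + η := by
        rw [add_add_add_comm, ← ENNReal.coe_add, add_halves]

theorem upperDini_const_mul {c : ℝ≥0∞} (hc : c ≠ ∞) :
    upperDini (fun δ => c * m δ) = c * upperDini m := by
  simp only [upperDini, mul_div_assoc]
  exact ENNReal.limsup_const_mul_of_ne_top hc

theorem upperDini_finset_sum_le {ι : Type*} (s : Finset ι) (m : ι → ℝ → ℝ≥0∞) :
    upperDini (fun δ => ∑ i ∈ s, m i δ) ≤ ∑ i ∈ s, upperDini (m i) := by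
  classical
  induction s using Finset.induction_on with
  | empty => simp [upperDini]
  | insert i s hi ih =>
    simp only [Finset.sum_insert hi]
    exact upperDini_add_le.trans (by gcongr)

theorem upperDini_comp_const_mul_le {c : ℝ} (hc : 0 < c) :
    upperDini (fun δ => m (c * δ)) ≤ ENNReal.ofReal c * upperDini m := by
  have hlim : Tendsto (fun δ => c * δ) (𝓝[>] 0) (𝓝[>] 0) :=
    tendsto_nhdsWithin_iff.2 ⟨(Continuous.tendsto' (by fun_prop) 0 0 (mul_zero c)).mono_left
      nhdsWithin_le_nhds, eventually_mem_nhdsWithin.mono fun δ hδ => mul_pos hc hδ⟩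
  calc upperDini (fun δ => m (c * δ))
      = limsup (fun δ => ENNReal.ofReal c * (m (c * δ) / ENNReal.ofReal (c * δ))) (𝓝[>] 0) := by
        refine limsup_congr (.of_forall fun δ => ?_)
        rw [ENNReal.ofReal_mul hc.le, ← mul_div_assoc, ENNReal.mul_div_mul_left _ _
          (ENNReal.ofReal_pos.2 hc).ne' ENNReal.ofReal_ne_top]
    _ = ENNReal.ofReal c * limsup (fun δ => m (c * δ) / ENNReal.ofReal (c * δ)) (𝓝[>] 0) :=
        ENNReal.limsup_const_mul_of_ne_top ENNReal.ofReal_ne_top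
    _ ≤ ENNReal.ofReal c * upperDini m := by
        gcongr
        exact hlim.limsup_comp_le_limsup (u := fun δ => m δ / ENNReal.ofReal δ)

theorem upperDini_lintegral_collar_le {X Y : Type*} [MeasurableSpace X] [PseudoMetricSpace Y]
    {μ : Measure X} {Γ : X → ℝ → Y} (hΓ : ∀ x s, dist (Γ x s) (Γ x 0) ≤ |s|)
    {φ : Y → ℝ} (hφ : UniformContinuous φ) {B : Set X} (hB : MeasurableSet B) (hμB : μ B ≠ ∞)
    (hsupp : ∀ x ∉ B, ∀ s, φ (Γ x s) = 0) :
    upperDini (fun δ => ∫⁻ x, (∫⁻ s in Ioc 0 δ, ‖φ (Γ x s)‖ₑ) ∂μ) ≤ ∫⁻ x, ‖φ (Γ x 0)‖ₑ ∂μ := by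
  refine upperDini_le_of_forall_eventually_le fun η hη => ?_
  obtain ⟨ω, hω, hωη⟩ := ENNReal.exists_nnreal_pos_mul_lt hμB hη
  obtain ⟨δ₀, hδ₀, hosc⟩ := Metric.uniformContinuous_iff.1 hφ ω (NNReal.coe_pos.2 hω)
  filter_upwards [Ioo_mem_nhdsGT hδ₀] with δ hδ
  have hpointwise : ∀ x, ∀ s ∈ Ioc 0 δ,
      ‖φ (Γ x s)‖ₑ ≤ ‖φ (Γ x 0)‖ₑ + B.indicator (fun _ => (ω : ℝ≥0∞)) x := fun x s hs => by
    by_cases hx : x ∈ B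
    · have hdist : dist (Γ x s) (Γ x 0) < δ₀ :=
        (hΓ x s).trans_lt ((abs_of_pos hs.1).trans_le hs.2 |>.trans_lt hδ.2)
      have hω' : ‖φ (Γ x s) - φ (Γ x 0)‖ₑ ≤ ω := by
        rw [enorm_eq_nnnorm, ENNReal.coe_le_coe, ← NNReal.coe_le_coe, coe_nnnorm, ← dist_eq_norm]
        exact (hosc hdist).le
      rw [indicator_of_mem hx, ← add_sub_cancel (φ (Γ x 0)) (φ (Γ x s))]
      exact (enorm_add_le _ _).trans (by gcongr)
    · simp [hsupp x hx]
  calc ∫⁻ x, (∫⁻ s in Ioc 0 δ, ‖φ (Γ x s)‖ₑ) ∂μ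
      ≤ ∫⁻ x, ENNReal.ofReal δ *
          (‖φ (Γ x 0)‖ₑ + B.indicator (fun _ => (ω : ℝ≥0∞)) x) ∂μ := by
        refine lintegral_mono fun x => (setLIntegral_mono measurable_const
          (hpointwise x)).trans_eq ?_
        rw [setLIntegral_const, Real.volume_Ioc, sub_zero, mul_comm]
    _ = ENNReal.ofReal δ * ((∫⁻ x, ‖φ (Γ x 0)‖ₑ ∂μ) + ω * μ B) := by
        rw [lintegral_const_mul' _ _ ENNReal.ofReal_ne_top,
          lintegral_add_right _ (measurable_const.indicator hB), lintegral_indicator_const hB]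
    _ ≤ ENNReal.ofReal δ * ((∫⁻ x, ‖φ (Γ x 0)‖ₑ ∂μ) + η) := by gcongr

end UpperDini

section HausdorffMeasure

theorem euclideanHausdorffMeasure_image_le_of_lipschitzWith {X Y : Type*} [EMetricSpace X]
    [EMetricSpace Y] [MeasurableSpace X] [BorelSpace X] [MeasurableSpace Y] [BorelSpace Y]
    {K : NNReal} {f : X → Y} (hf : LipschitzWith K f) (n : ℕ) (s : Set X) :
    μHE[n] (f '' s) ≤ (K : ℝ≥0∞) ^ n * μHE[n] s := by
  simp_rw [Measure.euclideanHausdorffMeasure_def, Measure.smul_apply]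
  rw [mul_smul_comm]
  gcongr
  simpa using (hf.lipschitzOnWith (s := s)).hausdorffMeasure_image_le (d := n) (by positivity)

theorem measurePreserving_affineIsometryEquiv {E F : Type*} [NormedAddCommGroup E]
    [InnerProductSpace ℝ E] [FiniteDimensional ℝ E] [MeasurableSpace E] [BorelSpace E]
    [NormedAddCommGroup F] [InnerProductSpace ℝ F] [FiniteDimensional ℝ F] [MeasurableSpace F]
    [BorelSpace F] (e : E ≃ᵃⁱ[ℝ] F) : MeasurePreserving e := by
  have h := e.toIsometryEquiv.measurePreserving_euclideanHausdorffMeasure (Module.finrank ℝ E)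
  rwa [InnerProductSpace.euclideanHausdorffMeasure_eq_volume,
    e.linearIsometryEquiv.toLinearEquiv.finrank_eq,
    InnerProductSpace.euclideanHausdorffMeasure_eq_volume] at h

end HausdorffMeasure

section GraphCollar

variable {E F : Type*} [NormedAddCommGroup E] [InnerProductSpace ℝ E] [NormedAddCommGroup F]
  [InnerProductSpace ℝ F]

/-- The point at signed height `s` above the graph of `f` over `y`, in the Cartesian coordinates
`e`. -/
noncomputable def graphCollar (e : E ≃ᵃⁱ[ℝ] WithLp 2 (F × ℝ)) (f : F → ℝ) (y : F) (s : ℝ) : E :=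
  e.symm (WithLp.toLp 2 (y, f y + s))

/-- The layer of width `δ` above the graph of `f` in the Cartesian coordinates `e`. -/
def graphLayer (e : E ≃ᵃⁱ[ℝ] WithLp 2 (F × ℝ)) (f : F → ℝ) (δ : ℝ) : Set E :=
  {x | (e x).snd - f (e x).fst ∈ Ioc 0 δ}

variable {e : E ≃ᵃⁱ[ℝ] WithLp 2 (F × ℝ)} {f : F → ℝ} {L : NNReal}

@[simp]
theorem fst_apply_graphCollar (y : F) (s : ℝ) : (e (graphCollar e f y s)).fst = y := by
  simp [graphCollar]

@[simp]
theorem snd_apply_graphCollar (y : F) (s : ℝ) : (e (graphCollar e f y s)).snd = f y + s := by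
  simp [graphCollar]

theorem graphCollar_fst_snd_sub (x : E) :
    graphCollar e f (e x).fst ((e x).snd - f (e x).fst) = x := by
  rw [graphCollar, add_sub_cancel]
  exact e.symm_apply_apply x

theorem dist_fst_apply_le (x x' : E) : dist (e x).fst (e x').fst ≤ dist x x' :=
  (WithLp.dist_fst_le _ _).trans_eq (e.dist_map x x')

theorem dist_snd_apply_le (x x' : E) : dist (e x).snd (e x').snd ≤ dist x x' :=
  (WithLp.dist_snd_le _ _).trans_eq (e.dist_map x x')

theorem continuous_fst_apply : Continuous fun x => (e x).fst :=
  (WithLp.continuous_fst 2 _ _).comp e.continuous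

theorem continuous_snd_apply : Continuous fun x => (e x).snd :=
  (WithLp.continuous_snd 2 _ _).comp e.continuous

theorem dist_graphCollar_le (y y' : F) (s s' : ℝ) :
    dist (graphCollar e f y s) (graphCollar e f y' s')
      ≤ dist y y' + dist (f y + s) (f y' + s') := by
  rw [graphCollar, graphCollar, e.symm.dist_map, WithLp.prod_dist_eq_of_L2]
  refine Real.sqrt_le_iff.2 ⟨by positivity, ?_⟩
  simp only [WithLp.toLp_fst, WithLp.toLp_snd]
  nlinarith [dist_nonneg (x := y) (y := y'), dist_nonneg (x := f y + s) (y := f y' + s')]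

theorem continuous_graphCollar (hf : Continuous f) :
    Continuous fun p : F × ℝ => graphCollar e f p.1 p.2 :=
  e.symm.continuous.comp ((WithLp.prod_continuous_toLp 2 F ℝ).comp (by fun_prop))

theorem lipschitzWith_graphCollar_zero (hf : LipschitzWith L f) :
    LipschitzWith (1 + L) fun y => graphCollar e f y 0 := by
  refine LipschitzWith.of_dist_le_mul fun y y' => (dist_graphCollar_le y y' 0 0).trans ?_
  have := hf.dist_le_mul y y'
  rw [add_zero, add_zero]
  push_cast
  linarith

theorem measurableSet_graphLayer [MeasurableSpace E] [OpensMeasurableSpace E] (hf : Continuous f)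
    (δ : ℝ) : MeasurableSet (graphLayer e f δ) :=
  (continuous_snd_apply.sub (hf.comp continuous_fst_apply)).measurable measurableSet_Ioc

variable [MeasurableSpace E] [BorelSpace E] [FiniteDimensional ℝ F] [MeasurableSpace F]
  [BorelSpace F]

theorem map_graphCollar_zero_le (hf : LipschitzWith L f) :
    Measure.map (fun y => graphCollar e f y 0) volume ≤ μHE[Module.finrank ℝ F] := by
  refine Measure.le_iff.2 fun A hA => ?_
  rw [Measure.map_apply (lipschitzWith_graphCollar_zero hf).continuous.measurable hA,
    ← InnerProductSpace.euclideanHausdorffMeasure_eq_volume]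
  have hproj : LipschitzWith 1 fun x => (e x).fst :=
    LipschitzWith.of_dist_le_mul fun x x' => by simpa using dist_fst_apply_le x x'
  calc μHE[Module.finrank ℝ F] ((fun y => graphCollar e f y 0) ⁻¹' A)
      ≤ μHE[Module.finrank ℝ F] ((fun x => (e x).fst) '' A) :=
        measure_mono fun y hy => ⟨_, hy, fst_apply_graphCollar y 0⟩
    _ ≤ μHE[Module.finrank ℝ F] A := by
        simpa using euclideanHausdorffMeasure_image_le_of_lipschitzWith hproj _ A

variable [FiniteDimensional ℝ E]

theorem measurePreserving_graphCollar (hf : Continuous f) :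
    MeasurePreserving (fun p : F × ℝ => graphCollar e f p.1 p.2) := by
  have hshear : MeasurePreserving (fun p : F × ℝ => (p.1, f p.1 + p.2)) :=
    (MeasurePreserving.id volume).skew_product (hf.measurable.comp measurable_fst |>.add
      measurable_snd) (.of_forall fun y => map_add_left_eq_self volume (f y))
  exact (measurePreserving_affineIsometryEquiv e.symm).comp
    ((WithLp.volume_preserving_toLp F ℝ).comp hshear)

theorem lintegral_prod_graphLayer (hf : Continuous f) (T δ : ℝ) {H : ℝ × E → ℝ≥0∞}
    (hH : Measurable H) :
    ∫⁻ z in Ioo 0 T ×ˢ graphLayer e f δ, H z =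
      ∫⁻ p in Ioo 0 T ×ˢ univ, ∫⁻ s in Ioc 0 δ, H (p.1, graphCollar e f p.2 s) := by
  have hΨ : MeasurePreserving fun p : (ℝ × F) × ℝ => (p.1.1, graphCollar e f p.1.2 p.2) :=
    ((MeasurePreserving.id volume).prod (measurePreserving_graphCollar (e := e) hf)).comp
      (measurePreserving_prodAssoc volume volume volume)
  have hpre : (fun p : (ℝ × F) × ℝ => (p.1.1, graphCollar e f p.1.2 p.2)) ⁻¹'
      (Ioo 0 T ×ˢ graphLayer e f δ) = (Ioo 0 T ×ˢ univ) ×ˢ Ioc 0 δ := by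
    ext p
    simp only [graphLayer, mem_preimage, mem_prod, mem_ofPred_eq, fst_apply_graphCollar,
      snd_apply_graphCollar, add_sub_cancel_left, mem_univ, and_true]
  rw [← hΨ.setLIntegral_comp_preimage
    (measurableSet_Ioo.prod (measurableSet_graphLayer hf δ)) hH, hpre, Measure.volume_eq_prod,
    ← Measure.prod_restrict]
  exact lintegral_prod _ (hH.comp hΨ.measurable).aemeasurable

end GraphCollar

/-- In the open set `U` and in the Cartesian coordinates `e`, the set `Ω` is the region above the
graph of the `L`-Lipschitz function `f`. -/
structure IsLipschitzGraphChart {E F : Type*} [NormedAddCommGroup E] [InnerProductSpace ℝ E]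
    [NormedAddCommGroup F] [InnerProductSpace ℝ F] (Ω U : Set E)
    (e : E ≃ᵃⁱ[ℝ] WithLp 2 (F × ℝ)) (f : F → ℝ) (L : NNReal) : Prop where
  isOpen : IsOpen U
  lipschitz : LipschitzWith L f
  inter_eq : U ∩ Ω = U ∩ {x | f (e x).fst < (e x).snd}

namespace IsLipschitzGraphChart

section Geometry

variable {E F : Type*} [NormedAddCommGroup E] [InnerProductSpace ℝ E] [NormedAddCommGroup F]
  [InnerProductSpace ℝ F] {Ω U : Set E} {e : E ≃ᵃⁱ[ℝ] WithLp 2 (F × ℝ)} {f : F → ℝ} {L : NNReal}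

theorem mem_iff (h : IsLipschitzGraphChart Ω U e f L) {x : E} (hx : x ∈ U) :
    x ∈ Ω ↔ f (e x).fst < (e x).snd := by
  simpa [hx] using Set.ext_iff.1 h.inter_eq x

theorem snd_eq_of_mem_frontier (h : IsLipschitzGraphChart Ω U e f L) {x : E} (hxU : x ∈ U)
    (hx : x ∈ frontier Ω) : (e x).snd = f (e x).fst := by
  have hfrontier : frontier {x | f (e x).fst < (e x).snd} ∩ U = frontier Ω ∩ U := by
    rw [← frontier_inter_open_inter h.isOpen, inter_comm {x | _} U, ← h.inter_eq, inter_comm U Ω,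
      frontier_inter_open_inter h.isOpen]
  have hmem : x ∈ frontier {x | f (e x).fst < (e x).snd} := (hfrontier.ge ⟨hx, hxU⟩).1
  exact (frontier_lt_subset_eq (h.lipschitz.continuous.comp continuous_fst_apply)
    continuous_snd_apply hmem).symm

theorem graphCollar_zero_mem_frontier (h : IsLipschitzGraphChart Ω U e f L) {y : F}
    (hy : graphCollar e f y 0 ∈ U) : graphCollar e f y 0 ∈ frontier Ω := by
  have hcont : Continuous (graphCollar e f y) :=
    (continuous_graphCollar h.lipschitz.continuous).comp (Continuous.prodMk_right y)
  refine ⟨mem_closure_of_tendsto (b := 𝓝[>] 0) (hcont.continuousAt.mono_left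
    nhdsWithin_le_nhds) ?_, fun hint => ?_⟩
  · filter_upwards [nhdsWithin_le_nhds (hcont.continuousAt.eventually_mem (h.isOpen.mem_nhds hy)),
      self_mem_nhdsWithin] with s hsU hs
    simpa [h.mem_iff hsU] using hs
  · simpa using (h.mem_iff hy).1 (interior_subset hint)

theorem mem_graphLayer (h : IsLipschitzGraphChart Ω U e f L) {x p : E} (hxU : x ∈ U)
    (hxΩ : x ∈ Ω) (hpU : p ∈ U) (hp : p ∈ frontier Ω) {δ : ℝ} (hxp : dist x p ≤ δ) :
    x ∈ graphLayer e f ((1 + L) * δ) := by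
  refine ⟨sub_pos.2 ((h.mem_iff hxU).1 hxΩ), ?_⟩
  have hheight : (e x).snd - (e p).snd ≤ dist x p :=
    (le_abs_self _).trans (dist_snd_apply_le x p)
  have hgraph : f (e p).fst - f (e x).fst ≤ L * dist x p := by
    refine (le_abs_self _).trans ((h.lipschitz.dist_le_mul _ _).trans ?_)
    rw [dist_comm x p]
    gcongr
    exact dist_fst_apply_le p x
  calc (e x).snd - f (e x).fst
      = ((e x).snd - (e p).snd) + (f (e p).fst - f (e x).fst) := by
        rw [h.snd_eq_of_mem_frontier hpU hp]; ring
    _ ≤ (1 + L) * dist x p := by linarith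
    _ ≤ (1 + L) * δ := by gcongr

theorem graphCollar_fst_zero_of_mem_frontier (h : IsLipschitzGraphChart Ω U e f L) {x : E}
    (hxU : x ∈ U) (hx : x ∈ frontier Ω) : graphCollar e f (e x).fst 0 = x := by
  simpa [h.snd_eq_of_mem_frontier hxU hx] using graphCollar_fst_snd_sub (e := e) (f := f) x

variable [MeasurableSpace E] [BorelSpace E] [FiniteDimensional ℝ F] [MeasurableSpace F]
  [BorelSpace F]

theorem map_restrict_graphCollar_zero_le (h : IsLipschitzGraphChart Ω U e f L) :
    Measure.map (fun y => graphCollar e f y 0)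
        (volume.restrict ((fun y => graphCollar e f y 0) ⁻¹' U))
      ≤ μHE[Module.finrank ℝ F].restrict (frontier Ω) := by
  have hγ : Measurable fun y => graphCollar e f y 0 :=
    (lipschitzWith_graphCollar_zero h.lipschitz).continuous.measurable
  calc Measure.map (fun y => graphCollar e f y 0)
        (volume.restrict ((fun y => graphCollar e f y 0) ⁻¹' U))
      ≤ Measure.map (fun y => graphCollar e f y 0)
        (volume.restrict ((fun y => graphCollar e f y 0) ⁻¹' frontier Ω)) :=
        Measure.map_mono (Measure.restrict_mono
          (fun _ hy => h.graphCollar_zero_mem_frontier hy) le_rfl) hγ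
    _ ≤ μHE[Module.finrank ℝ F].restrict (frontier Ω) := by
        rw [← Measure.restrict_map hγ isClosed_frontier.measurableSet]
        exact Measure.restrict_mono_measure (map_graphCollar_zero_le h.lipschitz) _

theorem hausdorffMeasure_ball_inter_frontier_lt_top (h : IsLipschitzGraphChart Ω U e f L)
    (x : E) (r : ℝ) : μHE[Module.finrank ℝ F] (U ∩ frontier Ω ∩ ball x r) < ∞ := by
  have hsub : U ∩ frontier Ω ∩ ball x r
      ⊆ (fun y => graphCollar e f y 0) '' closedBall (e x).fst r :=
        fun z hz => ⟨(e z).fst, (dist_fst_apply_le z x).trans (mem_ball.1 hz.2).le,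
        h.graphCollar_fst_zero_of_mem_frontier hz.1.1 hz.1.2⟩
  refine ((measure_mono hsub).trans (euclideanHausdorffMeasure_image_le_of_lipschitzWith
    (lipschitzWith_graphCollar_zero h.lipschitz) _ _)).trans_lt ?_
  rw [InnerProductSpace.euclideanHausdorffMeasure_eq_volume]
  exact ENNReal.mul_lt_top (by simp) (isCompact_closedBall _ _).measure_lt_top

end Geometry

section LateralMeasure

variable {d : ℕ} {Ω U : Set (EuclideanSpace ℝ (Fin d))}
  {e : EuclideanSpace ℝ (Fin d) ≃ᵃⁱ[ℝ] WithLp 2 (EuclideanSpace ℝ (Fin (d - 1)) × ℝ)}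
  {f : EuclideanSpace ℝ (Fin (d - 1)) → ℝ} {L : NNReal}

variable [SFinite (μHE[d - 1].restrict (frontier Ω))]

theorem lintegral_graphCollar_zero_le (h : IsLipschitzGraphChart Ω U e f L) {T : ℝ}
    {H : ℝ × EuclideanSpace ℝ (Fin d) → ℝ≥0∞} (hH : Measurable H)
    (hHU : ∀ t, ∀ x ∉ U, H (t, x) = 0) :
    ∫⁻ p in Ioo 0 T ×ˢ univ, H (p.1, graphCollar e f p.2 0) ≤ ∫⁻ z, H z ∂lateralMeasure T Ω := by
  have hγ : Measurable fun y => graphCollar e f y 0 :=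
    (lipschitzWith_graphCollar_zero h.lipschitz).continuous.measurable
  let γU : Set (EuclideanSpace ℝ (Fin (d - 1))) := (fun y => graphCollar e f y 0) ⁻¹' U
  have hsupp : (univ ×ˢ γU).indicator (fun p : ℝ × _ => H (p.1, graphCollar e f p.2 0))
      = fun p => H (p.1, graphCollar e f p.2 0) := by
    refine indicator_eq_self.2 fun p hp => ⟨trivial, ?_⟩
    by_contra hpU
    exact hp (hHU _ _ hpU)
  calc ∫⁻ p in Ioo 0 T ×ˢ univ, H (p.1, graphCollar e f p.2 0)
      = ∫⁻ p in Ioo 0 T ×ˢ γU, H (p.1, graphCollar e f p.2 0) := by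
        rw [← hsupp, setLIntegral_indicator (.prod .univ (hγ h.isOpen.measurableSet)), hsupp,
          prod_inter_prod, univ_inter, inter_univ]
    _ = ∫⁻ z, H z ∂(volume.restrict (Ioo 0 T)).prod
          (Measure.map (fun y => graphCollar e f y 0) (volume.restrict γU)) := by
        rw [Measure.volume_eq_prod, ← Measure.prod_restrict]
        conv_rhs => rw [← Measure.map_id (μ := volume.restrict (Ioo 0 T)),
          Measure.map_prod_map _ _ measurable_id hγ, lintegral_map hH (measurable_id.prodMap hγ)]
        rfl
    _ ≤ ∫⁻ z, H z ∂lateralMeasure T Ω := by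
        refine lintegral_mono' (Measure.prod_mono le_rfl ?_) le_rfl
        simpa using h.map_restrict_graphCollar_zero_le

theorem upperDini_lintegral_graphLayer_le (h : IsLipschitzGraphChart Ω U e f L) {T : ℝ}
    {φ : ℝ × EuclideanSpace ℝ (Fin d) → ℝ} (hφ : Continuous φ) (hφc : HasCompactSupport φ)
    (hφU : ∀ t, ∀ x ∉ U, φ (t, x) = 0) :
    upperDini (fun δ => ∫⁻ z in Ioo 0 T ×ˢ graphLayer e f δ, ‖φ z‖ₑ)
      ≤ ∫⁻ z, ‖φ z‖ₑ ∂lateralMeasure T Ω := by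
  let Γ (p : ℝ × EuclideanSpace ℝ (Fin (d - 1))) (s : ℝ) : ℝ × EuclideanSpace ℝ (Fin d) :=
    (p.1, graphCollar e f p.2 s)
  have hΓ (p : ℝ × EuclideanSpace ℝ (Fin (d - 1))) (s : ℝ) : dist (Γ p s) (Γ p 0) ≤ |s| := by
    simpa [Γ, Prod.dist_eq] using dist_graphCollar_le (e := e) (f := f) p.2 p.2 s 0
  let B : Set (ℝ × EuclideanSpace ℝ (Fin (d - 1))) :=
    (fun z => (z.1, (e z.2).fst)) '' tsupport φ
  have hB : IsCompact B := hφc.isCompact.image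
    (continuous_fst.prodMk (continuous_fst_apply.comp continuous_snd))
  have hsupp : ∀ p ∉ B, ∀ s, φ (Γ p s) = 0 := fun p hp s => by
    by_contra hne
    exact hp ⟨Γ p s, subset_tsupport φ hne, Prod.ext rfl (fst_apply_graphCollar _ _)⟩
  have hφe : Measurable fun z => ‖φ z‖ₑ := hφ.measurable.enorm
  simp_rw [lintegral_prod_graphLayer h.lipschitz.continuous T _ hφe]
  refine (upperDini_lintegral_collar_le hΓ (hφc.uniformContinuous_of_continuous hφ)
    hB.measurableSet hB.measure_lt_top.ne hsupp).trans ?_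
  exact h.lintegral_graphCollar_zero_le hφe fun t x hx => by rw [hφU t x hx, enorm_zero]

end LateralMeasure

end IsLipschitzGraphChart

/-- A choice of the local coordinates which witness that `Ω` has uniformly Lipschitz boundary. -/
structure LipschitzAtlas {d : ℕ} (Ω : Set (EuclideanSpace ℝ (Fin d))) where
  radius : ℝ
  radius_pos : 0 < radius
  lipschitzConst : NNReal
  multiplicity : ℕ
  U : ℕ → Set (EuclideanSpace ℝ (Fin d))
  e : ℕ → EuclideanSpace ℝ (Fin d) ≃ᵃⁱ[ℝ] WithLp 2 (EuclideanSpace ℝ (Fin (d - 1)) × ℝ)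
  f : ℕ → EuclideanSpace ℝ (Fin (d - 1)) → ℝ
  isChart : ∀ n, IsLipschitzGraphChart Ω (U n) (e n) (f n) lipschitzConst
  locallyFinite : LocallyFinite U
  exists_ball_subset : ∀ x ∈ frontier Ω, ∃ n, ball x radius ⊆ U n
  encard_le : ∀ x, {n | x ∈ U n}.encard ≤ multiplicity

theorem HasUniformlyLipschitzBoundary.nonempty_lipschitzAtlas {d : ℕ}
    {Ω : Set (EuclideanSpace ℝ (Fin d))} (h : HasUniformlyLipschitzBoundary Ω) :
    Nonempty (LipschitzAtlas Ω) := by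
  obtain ⟨ε, L, M, U, hε, -, hopen, hloc, -, hball, hcard, hchart⟩ := h
  choose e f hf using hchart
  exact ⟨ε, hε, L, M, U, e, f, fun n => ⟨hopen n, (hf n).1, (hf n).2⟩, hloc, hball, hcard⟩

namespace LipschitzAtlas

variable {d : ℕ} {Ω : Set (EuclideanSpace ℝ (Fin d))}

theorem exists_mem (𝒜 : LipschitzAtlas Ω) {x : EuclideanSpace ℝ (Fin d)} (hx : x ∈ frontier Ω) :
    ∃ n, x ∈ 𝒜.U n :=
  (𝒜.exists_ball_subset x hx).imp fun _ h => h (mem_ball_self 𝒜.radius_pos)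

theorem isLocallyFiniteMeasure_hausdorffMeasure (𝒜 : LipschitzAtlas Ω) :
    IsLocallyFiniteMeasure ((μHE[d - 1] : Measure (EuclideanSpace ℝ (Fin d))).restrict
      (frontier Ω)) := by
  refine ⟨fun x => ?_⟩
  obtain ⟨r, hr, hfin⟩ : ∃ r > 0, {n | (𝒜.U n ∩ ball x r).Nonempty}.Finite := by
    obtain ⟨s, hs, hfin⟩ := 𝒜.locallyFinite x
    obtain ⟨r, hr, hrs⟩ := Metric.mem_nhds_iff.1 hs
    exact ⟨r, hr, hfin.subset fun n hn => hn.mono (inter_subset_inter_right _ hrs)⟩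
  have hcover : ball x r ∩ frontier Ω
      ⊆ ⋃ n ∈ {n | (𝒜.U n ∩ ball x r).Nonempty}, 𝒜.U n ∩ frontier Ω ∩ ball x r := by
    rintro z ⟨hzx, hz⟩
    obtain ⟨n, hn⟩ := 𝒜.exists_mem hz
    exact mem_biUnion (show (𝒜.U n ∩ ball x r).Nonempty from ⟨z, hn, hzx⟩) ⟨⟨hn, hz⟩, hzx⟩
  refine ⟨ball x r, ball_mem_nhds x hr, ?_⟩
  rw [Measure.restrict_apply measurableSet_ball]
  refine (measure_mono hcover).trans_lt (measure_biUnion_lt_top hfin fun n _ => ?_)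
  simpa using (𝒜.isChart n).hausdorffMeasure_ball_inter_frontier_lt_top x r

theorem isLocallyFiniteMeasure_lateralMeasure (𝒜 : LipschitzAtlas Ω) (T : ℝ) :
    IsLocallyFiniteMeasure (lateralMeasure T Ω) := by
  have := 𝒜.isLocallyFiniteMeasure_hausdorffMeasure
  rw [lateralMeasure]
  infer_instance

variable (𝒜 : LipschitzAtlas Ω)

/-- A continuous function with values in `[0, 1]`, supported in `U n`, equal to `1` at the points of
`U n` which are at distance at least `radius / 2` from the complement. -/
noncomputable def weight (n : ℕ) (x : EuclideanSpace ℝ (Fin d)) : NNReal :=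
  thickenedIndicator (half_pos 𝒜.radius_pos) {x | ball x (𝒜.radius / 2) ⊆ 𝒜.U n} x

theorem continuous_weight (n : ℕ) : Continuous (𝒜.weight n) :=
  (thickenedIndicator _ _).continuous

theorem weight_eq_zero {n : ℕ} {x : EuclideanSpace ℝ (Fin d)} (hx : x ∉ 𝒜.U n) :
    𝒜.weight n x = 0 := by
  refine thickenedIndicator_zero _ _ fun hmem => hx ?_
  obtain ⟨v, hv, hxv⟩ := mem_thickening_iff.1 hmem
  exact hv hxv

theorem exists_weight_eq_one {p : EuclideanSpace ℝ (Fin d)} (hp : p ∈ frontier Ω) :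
    ∃ n, p ∈ 𝒜.U n ∧ ∀ x, dist x p ≤ 𝒜.radius / 2 → 𝒜.weight n x = 1 := by
  obtain ⟨n, hn⟩ := 𝒜.exists_ball_subset p hp
  refine ⟨n, hn (mem_ball_self 𝒜.radius_pos), fun x hx => thickenedIndicator_one _ _ ?_⟩
  exact (ball_subset_ball' (by linarith)).trans hn

theorem sum_weight_le (N : Finset ℕ) (x : EuclideanSpace ℝ (Fin d)) :
    ∑ n ∈ N, 𝒜.weight n x ≤ 𝒜.multiplicity := by
  classical
  have hcard : (({n ∈ N | x ∈ 𝒜.U n} : Finset ℕ).card : ℕ∞) ≤ 𝒜.multiplicity := by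
    rw [← Set.encard_coe_eq_coe_finsetCard]
    exact (encard_le_encard fun n hn => (Finset.mem_filter.1 hn).2).trans (𝒜.encard_le x)
  calc ∑ n ∈ N, 𝒜.weight n x = ∑ n ∈ N with x ∈ 𝒜.U n, 𝒜.weight n x :=
        (Finset.sum_filter_of_ne fun n _ hne => by_contra fun hx => hne (𝒜.weight_eq_zero hx)).symm
    _ ≤ ({n ∈ N | x ∈ 𝒜.U n} : Finset ℕ).card • 1 :=
        Finset.sum_le_card_nsmul _ _ _ fun n _ => thickenedIndicator_le_one _ _ x
    _ ≤ 𝒜.multiplicity := by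
        rw [nsmul_one]
        exact_mod_cast hcard

theorem exists_finset_forall_lintegral_layer_le (T : ℝ) {φ : ℝ × EuclideanSpace ℝ (Fin d) → ℝ}
    (hφ : Continuous φ) (hφc : HasCompactSupport φ) :
    ∃ N : Finset ℕ, ∀ δ ≤ 𝒜.radius / 2,
      ∫⁻ z in Ioo 0 T ×ˢ (Ω ∩ thickening δ (frontier Ω)), ‖φ z‖ₑ
        ≤ ∑ n ∈ N, ∫⁻ z in Ioo 0 T ×ˢ graphLayer (𝒜.e n) (𝒜.f n) ((1 + 𝒜.lipschitzConst) * δ),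
            ‖𝒜.weight n z.2 * φ z‖ₑ := by
  have hfin := 𝒜.locallyFinite.finite_nonempty_inter_compact (hφc.isCompact.image continuous_snd)
  refine ⟨hfin.toFinset, fun δ hδ => ?_⟩
  let S (n : ℕ) : Set (ℝ × EuclideanSpace ℝ (Fin d)) :=
    Ioo 0 T ×ˢ graphLayer (𝒜.e n) (𝒜.f n) ((1 + 𝒜.lipschitzConst) * δ)
  have hS (n : ℕ) : MeasurableSet (S n) :=
    measurableSet_Ioo.prod (measurableSet_graphLayer (𝒜.isChart n).lipschitz.continuous _)
  have hmeas (n : ℕ) : Measurable ((S n).indicator fun z => ‖𝒜.weight n z.2 * φ z‖ₑ) := by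
    have := 𝒜.continuous_weight n
    exact Measurable.indicator (by fun_prop) (hS n)
  have hpointwise : ∀ z ∈ Ioo 0 T ×ˢ (Ω ∩ thickening δ (frontier Ω)),
      ‖φ z‖ₑ ≤ ∑ n ∈ hfin.toFinset, (S n).indicator (fun z => ‖𝒜.weight n z.2 * φ z‖ₑ) z := by
    rintro z ⟨hzt, hzΩ, hzδ⟩
    by_cases hφz : φ z = 0
    · simp [hφz]
    obtain ⟨p, hp, hzp⟩ := mem_thickening_iff.1 hzδ
    obtain ⟨n, hpn, hn⟩ := 𝒜.exists_weight_eq_one hp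
    have hweight : 𝒜.weight n z.2 = 1 := hn z.2 (hzp.le.trans hδ)
    have hzn : z.2 ∈ 𝒜.U n := by
      by_contra hzn
      exact one_ne_zero (hweight.symm.trans (𝒜.weight_eq_zero hzn))
    have hnN : n ∈ hfin.toFinset :=
      hfin.mem_toFinset.2 ⟨z.2, hzn, z, subset_tsupport φ hφz, rfl⟩
    refine le_trans ?_ (Finset.single_le_sum (fun _ _ => zero_le) hnN)
    have hzS : z ∈ S n := ⟨hzt, (𝒜.isChart n).mem_graphLayer hzn hzΩ hpn hp hzp.le⟩
    rw [indicator_of_mem hzS, hweight, NNReal.coe_one, one_mul]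
  calc ∫⁻ z in Ioo 0 T ×ˢ (Ω ∩ thickening δ (frontier Ω)), ‖φ z‖ₑ
      ≤ ∫⁻ z in Ioo 0 T ×ˢ (Ω ∩ thickening δ (frontier Ω)),
          ∑ n ∈ hfin.toFinset, (S n).indicator (fun z => ‖𝒜.weight n z.2 * φ z‖ₑ) z :=
        setLIntegral_mono (Finset.measurable_sum _ fun n _ => hmeas n) hpointwise
    _ ≤ ∫⁻ z, ∑ n ∈ hfin.toFinset, (S n).indicator (fun z => ‖𝒜.weight n z.2 * φ z‖ₑ) z :=
        setLIntegral_le_lintegral _ _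
    _ = ∑ n ∈ hfin.toFinset, ∫⁻ z in S n, ‖𝒜.weight n z.2 * φ z‖ₑ := by
        rw [lintegral_finsetSum _ fun n _ => hmeas n]
        exact Finset.sum_congr rfl fun n _ => lintegral_indicator (hS n) _

theorem upperDini_lintegral_layer_le (T : ℝ) {φ : ℝ × EuclideanSpace ℝ (Fin d) → ℝ}
    (hφ : Continuous φ) (hφc : HasCompactSupport φ) :
    upperDini (fun δ => ∫⁻ z in Ioo 0 T ×ˢ (Ω ∩ thickening δ (frontier Ω)), ‖φ z‖ₑ)
      ≤ ENNReal.ofReal (1 + 𝒜.lipschitzConst) * (𝒜.multiplicity *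
        ∫⁻ z, ‖φ z‖ₑ ∂lateralMeasure T Ω) := by
  have := 𝒜.isLocallyFiniteMeasure_hausdorffMeasure
  obtain ⟨N, hN⟩ := 𝒜.exists_finset_forall_lintegral_layer_le T hφ hφc
  let H (n : ℕ) (z : ℝ × EuclideanSpace ℝ (Fin d)) : ℝ := 𝒜.weight n z.2 * φ z
  have hH (n : ℕ) : Continuous (H n) := by
    have := 𝒜.continuous_weight n
    fun_prop
  let m (n : ℕ) (δ : ℝ) : ℝ≥0∞ := ∫⁻ z in Ioo 0 T ×ˢ graphLayer (𝒜.e n) (𝒜.f n) δ, ‖H n z‖ₑ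
  have hm (n : ℕ) : upperDini (m n) ≤ ∫⁻ z, ‖H n z‖ₑ ∂lateralMeasure T Ω :=
    (𝒜.isChart n).upperDini_lintegral_graphLayer_le (hH n) hφc.mul_left
      fun t x hx => by simp [H, 𝒜.weight_eq_zero hx]
  have hsum (z : ℝ × EuclideanSpace ℝ (Fin d)) : ∑ n ∈ N, ‖H n z‖ₑ ≤ 𝒜.multiplicity * ‖φ z‖ₑ := by
    simp_rw [H, enorm_mul, ← Finset.sum_mul]
    gcongr
    simpa using ENNReal.coe_le_coe.2 (𝒜.sum_weight_le N z.2)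
  calc upperDini (fun δ => ∫⁻ z in Ioo 0 T ×ˢ (Ω ∩ thickening δ (frontier Ω)), ‖φ z‖ₑ)
      ≤ upperDini (fun δ => ∑ n ∈ N, m n ((1 + 𝒜.lipschitzConst) * δ)) :=
        upperDini_mono <| nhdsWithin_le_nhds <|
          (eventually_le_nhds (half_pos 𝒜.radius_pos)).mono hN
    _ ≤ ∑ n ∈ N, upperDini (fun δ => m n ((1 + 𝒜.lipschitzConst) * δ)) :=
        upperDini_finset_sum_le _ _
    _ ≤ ∑ n ∈ N, ENNReal.ofReal (1 + 𝒜.lipschitzConst) *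
          ∫⁻ z, ‖H n z‖ₑ ∂lateralMeasure T Ω :=
        Finset.sum_le_sum fun n _ => (upperDini_comp_const_mul_le (by positivity)).trans
          (mul_le_mul_right (hm n) _)
    _ = ENNReal.ofReal (1 + 𝒜.lipschitzConst) *
          ∫⁻ z, ∑ n ∈ N, ‖H n z‖ₑ ∂lateralMeasure T Ω := by
        rw [lintegral_finsetSum _ fun n _ => (hH n).measurable.enorm, Finset.mul_sum]
    _ ≤ ENNReal.ofReal (1 + 𝒜.lipschitzConst) *
          (𝒜.multiplicity * ∫⁻ z, ‖φ z‖ₑ ∂lateralMeasure T Ω) := by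
        rw [← lintegral_const_mul _ hφ.measurable.enorm]
        gcongr with z
        exact hsum z

end LipschitzAtlas

section InitialLayer

variable {E : Type*} [NormedAddCommGroup E] [InnerProductSpace ℝ E] [FiniteDimensional ℝ E]
  [MeasurableSpace E] [BorelSpace E]

/-- The Lebesgue measure on the initial face `{0} × Ω` of the cylinder. -/
noncomputable def initialMeasure (Ω : Set E) : Measure (ℝ × E) :=
  (Measure.dirac 0).prod (volume.restrict Ω)

theorem lintegral_initialMeasure (Ω : Set E) {H : ℝ × E → ℝ≥0∞} (hH : Measurable H) :
    ∫⁻ z, H z ∂initialMeasure Ω = ∫⁻ x in Ω, H (0, x) := by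
  rw [initialMeasure, lintegral_prod _ hH.aemeasurable,
    lintegral_dirac' _ hH.lintegral_prod_right']

theorem upperDini_lintegral_Ioc_prod_le (Ω : Set E) {φ : ℝ × E → ℝ} (hφ : Continuous φ)
    (hφc : HasCompactSupport φ) :
    upperDini (fun δ => ∫⁻ z in Ioc 0 δ ×ˢ Ω, ‖φ z‖ₑ) ≤ ∫⁻ z, ‖φ z‖ₑ ∂initialMeasure Ω := by
  have hφe : Measurable fun z => ‖φ z‖ₑ := hφ.measurable.enorm
  have hB : IsCompact (Prod.snd '' tsupport φ) := hφc.isCompact.image continuous_snd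
  have hsupp : ∀ x ∉ Prod.snd '' tsupport φ, ∀ s, φ (s, x) = 0 := fun x hx s => by
    by_contra hne
    exact hx ⟨(s, x), subset_tsupport φ hne, rfl⟩
  have hcollar := upperDini_lintegral_collar_le (μ := volume.restrict Ω)
    (Γ := fun x s => (s, x)) (by simp [Prod.dist_eq])
    (hφc.uniformContinuous_of_continuous hφ) hB.measurableSet hB.measure_lt_top.ne hsupp
  rw [lintegral_initialMeasure Ω hφe]
  convert hcollar using 3 with δ
  rw [Measure.volume_eq_prod, ← Measure.prod_restrict, lintegral_prod_symm _ hφe.aemeasurable]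

end InitialLayer

section Cutoff

variable {E : Type*} [NormedAddCommGroup E] [NormedSpace ℝ E]

theorem exists_contDiff_lipschitzWith_one_approx [FiniteDimensional ℝ E] {G : E → ℝ}
    (hG : LipschitzWith 1 G) {δ : ℝ} (hδ : 0 < δ) :
    ∃ g : E → ℝ, ContDiff ℝ (⊤ : ℕ∞) g ∧ LipschitzWith 1 g ∧ ∀ x, |g x - G x| ≤ δ := by
  borelize E
  let μ : Measure E := Measure.addHaar
  let ρ : ContDiffBump (0 : E) := ⟨δ / 2, δ, half_pos hδ, half_lt_self hδ⟩
  have hint (x : E) : Integrable (fun t => ρ.normed μ t * G (x - t)) μ :=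
    (ρ.continuous_normed.mul
      (hG.continuous.comp (continuous_sub_left x))).integrable_of_hasCompactSupport
      ρ.hasCompactSupport_normed.mul_right
  refine ⟨convolution (ρ.normed μ) G (ContinuousLinearMap.lsmul ℝ ℝ) μ, ?_, ?_, fun x => ?_⟩
  · exact ρ.hasCompactSupport_normed.contDiff_convolution_left _ ρ.contDiff_normed
      hG.continuous.locallyIntegrable
  · refine LipschitzWith.of_dist_le_mul fun x x' => ?_
    simp only [convolution_def, ContinuousLinearMap.lsmul_apply, smul_eq_mul, NNReal.coe_one,
      one_mul]
    rw [dist_eq_norm, ← integral_sub (hint x) (hint x')]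
    calc ‖∫ t, ρ.normed μ t * G (x - t) - ρ.normed μ t * G (x' - t) ∂μ‖
        ≤ ∫ t, ρ.normed μ t * dist x x' ∂μ := by
          refine norm_integral_le_of_norm_le (ρ.integrable_normed.mul_const _)
            (.of_forall fun t => ?_)
          rw [← mul_sub, norm_mul, Real.norm_of_nonneg (ρ.nonneg_normed t), ← dist_eq_norm]
          exact mul_le_mul_of_nonneg_left (by simpa using hG.dist_le_mul (x - t) (x' - t))
            (ρ.nonneg_normed t)
      _ = dist x x' := by rw [integral_mul_const, ρ.integral_normed, one_mul]
  · rw [← Real.dist_eq]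
    refine ρ.dist_normed_convolution_le hG.continuous.aestronglyMeasurable fun y hy => ?_
    simpa using (hG.dist_le_mul y x).trans (by simpa using (mem_ball.1 hy).le)

/-- A smooth substitute, accurate up to a fraction of `δ`, for the distance of a point of `Ω` to the
boundary. -/
structure IsRegularizedDistance (Ω : Set E) (δ : ℝ) (g : E → ℝ) : Prop where
  contDiff : ContDiff ℝ (⊤ : ℕ∞) g
  lipschitz : LipschitzWith 1 g
  mem_of_le : ∀ x, δ / 3 ≤ g x → x ∈ Ω
  le_of_notMem_thickening : ∀ x ∈ Ω, x ∉ thickening δ (frontier Ω) → 2 * δ / 3 ≤ g x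

theorem exists_isRegularizedDistance [FiniteDimensional ℝ E] (Ω : Set E) {δ : ℝ} (hδ : 0 < δ) :
    ∃ g, IsRegularizedDistance Ω δ g := by
  rcases eq_or_ne Ω univ with rfl | hΩ
  · exact ⟨fun _ => δ, contDiff_const, LipschitzWith.const' _, fun _ _ => trivial,
      fun _ _ _ => by linarith⟩
  obtain ⟨g, hg, hgL, hgG⟩ := exists_contDiff_lipschitzWith_one_approx
    (lipschitz_infDist_pt Ωᶜ) (by positivity : 0 < δ / 6)
  refine ⟨g, hg, hgL, fun x hx => ?_, fun x hxΩ hx => ?_⟩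
  · by_contra hxΩ
    have := (abs_le.1 (hgG x)).2
    rw [infDist_zero_of_mem hxΩ] at this
    linarith
  · obtain ⟨y, hy, hxy⟩ := exists_mem_frontier_infDist_compl_eq_dist hxΩ hΩ
    have hdist : δ ≤ dist x y := not_lt.1 fun h => hx (mem_thickening_iff.2 ⟨y, hy, h⟩)
    linarith [(abs_le.1 (hgG x)).1]

theorem exists_norm_deriv_smoothTransition_le :
    ∃ A : NNReal, ∀ s, ‖deriv Real.smoothTransition s‖ ≤ A := by
  have hderiv : ∀ s ∉ Icc (0 : ℝ) 1, deriv Real.smoothTransition s = 0 := fun s hs => by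
    rcases lt_or_ge s 0 with hs0 | hs0
    · refine IsLocalMin.deriv_eq_zero (.of_forall fun r => ?_)
      rw [Real.smoothTransition.zero_of_nonpos hs0.le]
      exact Real.smoothTransition.nonneg r
    · refine IsLocalMax.deriv_eq_zero (.of_forall fun r => ?_)
      rw [Real.smoothTransition.one_of_one_le (le_of_not_ge fun h => hs ⟨hs0, h⟩)]
      exact Real.smoothTransition.le_one r
  obtain ⟨A, hA⟩ := (HasCompactSupport.intro isCompact_Icc hderiv).exists_bound_of_continuous
    ((Real.smoothTransition.contDiff (n := 1)).continuous_deriv le_rfl)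
  exact ⟨A.toNNReal, fun s => (hA s).trans (Real.le_coe_toNNReal A)⟩

/-- A smooth nondecreasing function which is `0` on `]-∞, δ/3]` and `1` on `[2δ/3, ∞[`. -/
noncomputable def ramp (δ s : ℝ) : ℝ :=
  Real.smoothTransition (3 * s / δ - 1)

theorem contDiff_ramp (δ : ℝ) : ContDiff ℝ (⊤ : ℕ∞) (ramp δ) :=
  Real.smoothTransition.contDiff.comp
    (((contDiff_const.mul contDiff_id).div_const δ).sub contDiff_const)

theorem ramp_mem_Icc (δ s : ℝ) : ramp δ s ∈ Icc (0 : ℝ) 1 :=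
  ⟨Real.smoothTransition.nonneg _, Real.smoothTransition.le_one _⟩

theorem norm_ramp_le (δ s : ℝ) : ‖ramp δ s‖ ≤ 1 := by
  rw [Real.norm_of_nonneg (ramp_mem_Icc δ s).1]
  exact (ramp_mem_Icc δ s).2

theorem lt_of_ramp_ne_zero {δ s : ℝ} (hδ : 0 < δ) (h : ramp δ s ≠ 0) : δ / 3 < s := by
  by_contra! hs
  refine h (Real.smoothTransition.zero_of_nonpos ?_)
  rw [sub_nonpos, div_le_one hδ]
  linarith

theorem ramp_eq_one {δ s : ℝ} (hδ : 0 < δ) (hs : 2 * δ / 3 ≤ s) : ramp δ s = 1 := by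
  refine Real.smoothTransition.one_of_one_le ?_
  rw [le_sub_iff_add_le, le_div_iff₀ hδ]
  linarith

theorem deriv_ramp_eq_zero {δ s : ℝ} (hδ : 0 < δ) (hs : 2 * δ / 3 ≤ s) : deriv (ramp δ) s = 0 :=
  IsLocalMax.deriv_eq_zero <| .of_forall fun r => by
    rw [ramp_eq_one hδ hs]
    exact (ramp_mem_Icc δ r).2

theorem exists_enorm_deriv_ramp_le :
    ∃ A : NNReal, ∀ δ > 0, ∀ s, ‖deriv (ramp δ) s‖ₑ ≤ A / ENNReal.ofReal δ := by
  obtain ⟨A, hA⟩ := exists_norm_deriv_smoothTransition_le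
  refine ⟨3 * A, fun δ hδ s => ?_⟩
  have hinner : HasDerivAt (fun s : ℝ => 3 * s / δ - 1) (3 / δ) s := by
    simpa using (((hasDerivAt_id s).const_mul 3).div_const δ).sub_const 1
  have houter := ((Real.smoothTransition.contDiff (n := 1)).differentiable one_ne_zero
    (3 * s / δ - 1)).hasDerivAt
  have hderiv : deriv (ramp δ) s = deriv Real.smoothTransition (3 * s / δ - 1) * (3 / δ) :=
    (houter.comp s hinner).deriv
  have hnorm : ‖deriv (ramp δ) s‖ ≤ 3 * A / δ := by
    rw [hderiv, norm_mul, Real.norm_of_nonneg (by positivity : 0 ≤ 3 / δ), mul_comm,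
      div_mul_eq_mul_div]
    gcongr
    exact hA _
  calc ‖deriv (ramp δ) s‖ₑ ≤ ENNReal.ofReal (3 * A / δ) := by
        rw [← ofReal_norm]
        exact ENNReal.ofReal_le_ofReal hnorm
    _ = (3 * A : NNReal) / ENNReal.ofReal δ := by
        rw [ENNReal.ofReal_div_of_pos hδ, ← NNReal.coe_ofNat, ← NNReal.coe_mul,
          ENNReal.ofReal_coe_nnreal]

/-- A smooth cutoff function in space-time which is supported in `t > 0`, `x ∈ Ω` and differs from
`1` only in the layers of width `δ` at the initial and at the lateral boundary; its derivative is
of order `δ⁻¹` there. -/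
structure IsInteriorCutoff (Ω : Set E) (A : NNReal) (δ : ℝ) (κ : ℝ × E → ℝ) : Prop where
  contDiff : ContDiff ℝ (⊤ : ℕ∞) κ
  mem_Icc : ∀ z, κ z ∈ Icc (0 : ℝ) 1
  tsupport_subset : tsupport κ ⊆ Ioi 0 ×ˢ Ω
  eq_one : ∀ z ∈ Ioi δ ×ˢ (Ω \ thickening δ (frontier Ω)), κ z = 1
  enorm_fderiv_le : ∀ z : ℝ × E, z.2 ∈ Ω → ∀ v : ℝ × E, ‖fderiv ℝ κ z v‖ₑ ≤
    A / ENNReal.ofReal δ * ((Iic δ).indicator (fun _ => ‖v.1‖ₑ) z.1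
      + (thickening δ (frontier Ω)).indicator (fun _ => ‖v.2‖ₑ) z.2)

namespace IsRegularizedDistance

variable {Ω : Set E} {δ : ℝ} {g : E → ℝ}

theorem fderiv_ramp_mul_ramp (hg : IsRegularizedDistance Ω δ g) (z v : ℝ × E) :
    fderiv ℝ (fun z : ℝ × E => ramp δ z.1 * ramp δ (g z.2)) z v =
      ramp δ z.1 * (deriv (ramp δ) (g z.2) * fderiv ℝ g z.2 v.2)
        + ramp δ (g z.2) * (deriv (ramp δ) z.1 * v.1) := by
  have hramp (s : ℝ) : HasDerivAt (ramp δ) (deriv (ramp δ) s) s :=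
    ((contDiff_ramp δ).differentiable (by simp) s).hasDerivAt
  have hfst : HasFDerivAt Prod.fst (ContinuousLinearMap.fst ℝ ℝ E) z := hasFDerivAt_fst
  have hsnd : HasFDerivAt Prod.snd (ContinuousLinearMap.snd ℝ ℝ E) z := hasFDerivAt_snd
  have hgsnd : HasFDerivAt (fun z : ℝ × E => g z.2) _ z :=
    (hg.contDiff.differentiable (by simp) z.2).hasFDerivAt.comp z hsnd
  have htime := (hramp z.1).comp_hasFDerivAt (f := Prod.fst) z hfst
  have hspace := (hramp (g z.2)).comp_hasFDerivAt (f := fun z : ℝ × E => g z.2) z hgsnd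
  refine (DFunLike.congr_fun (htime.mul hspace).fderiv v).trans ?_
  simp

theorem enorm_fderiv_ramp_mul_ramp_le (hg : IsRegularizedDistance Ω δ g) (hδ : 0 < δ) {A : NNReal}
    (hA : ∀ s, ‖deriv (ramp δ) s‖ₑ ≤ A / ENNReal.ofReal δ) {z : ℝ × E} (hz : z.2 ∈ Ω) (v : ℝ × E) :
    ‖fderiv ℝ (fun z : ℝ × E => ramp δ z.1 * ramp δ (g z.2)) z v‖ₑ ≤
      A / ENNReal.ofReal δ * ((Iic δ).indicator (fun _ => ‖v.1‖ₑ) z.1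
        + (thickening δ (frontier Ω)).indicator (fun _ => ‖v.2‖ₑ) z.2) := by
  have hle (s : ℝ) : ‖ramp δ s‖ₑ ≤ 1 := by
    rw [← ofReal_norm]
    exact ENNReal.ofReal_le_one.2 (norm_ramp_le δ s)
  have htime : ‖deriv (ramp δ) z.1 * v.1‖ₑ
      ≤ A / ENNReal.ofReal δ * (Iic δ).indicator (fun _ => ‖v.1‖ₑ) z.1 := by
    by_cases ht : z.1 ≤ δ
    · rw [indicator_of_mem (mem_Iic.2 ht), enorm_mul]
      gcongr
      exact hA _
    · rw [deriv_ramp_eq_zero hδ (by linarith)]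
      simp
  have hspace : ‖deriv (ramp δ) (g z.2) * fderiv ℝ g z.2 v.2‖ₑ ≤ A / ENNReal.ofReal δ *
      (thickening δ (frontier Ω)).indicator (fun _ => ‖v.2‖ₑ) z.2 := by
    by_cases hzδ : z.2 ∈ thickening δ (frontier Ω)
    · rw [indicator_of_mem hzδ, enorm_mul]
      gcongr
      · exact hA _
      · refine enorm_le_iff_norm_le.2 ?_
        simpa using (fderiv ℝ g z.2).le_of_opNorm_le
          (norm_fderiv_le_of_lipschitz ℝ hg.lipschitz) v.2
    · rw [deriv_ramp_eq_zero hδ (hg.le_of_notMem_thickening _ hz hzδ)]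
      simp
  rw [hg.fderiv_ramp_mul_ramp, mul_add, add_comm]
  refine (enorm_add_le _ _).trans (add_le_add ?_ ?_)
  · rw [enorm_mul]
    exact (mul_le_of_le_one_left' (hle _)).trans htime
  · rw [enorm_mul]
    exact (mul_le_of_le_one_left' (hle _)).trans hspace

theorem isInteriorCutoff (hg : IsRegularizedDistance Ω δ g) (hδ : 0 < δ) {A : NNReal}
    (hA : ∀ s, ‖deriv (ramp δ) s‖ₑ ≤ A / ENNReal.ofReal δ) :
    IsInteriorCutoff Ω A δ fun z => ramp δ z.1 * ramp δ (g z.2) where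
  contDiff := ((contDiff_ramp δ).comp contDiff_fst).mul
    ((contDiff_ramp δ).comp (hg.contDiff.comp contDiff_snd))
  mem_Icc z := ⟨mul_nonneg (ramp_mem_Icc _ _).1 (ramp_mem_Icc _ _).1,
    mul_le_one₀ (ramp_mem_Icc _ _).2 (ramp_mem_Icc _ _).1 (ramp_mem_Icc _ _).2⟩
  tsupport_subset := by
    have hclosed : IsClosed {z : ℝ × E | δ / 3 ≤ z.1 ∧ δ / 3 ≤ g z.2} :=
      (isClosed_le continuous_const continuous_fst).inter
        (isClosed_le continuous_const (hg.contDiff.continuous.comp continuous_snd))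
    refine (closure_minimal (fun z hz => ?_) hclosed).trans
      fun z hz => ⟨(by positivity : 0 < δ / 3).trans_le hz.1, hg.mem_of_le _ hz.2⟩
    exact ⟨(lt_of_ramp_ne_zero hδ (left_ne_zero_of_mul hz)).le,
      (lt_of_ramp_ne_zero hδ (right_ne_zero_of_mul hz)).le⟩
  eq_one := fun z ⟨hz, hzΩ, hzδ⟩ => by
    rw [ramp_eq_one hδ (by linarith [mem_Ioi.1 hz]),
      ramp_eq_one hδ (hg.le_of_notMem_thickening _ hzΩ hzδ), mul_one]
  enorm_fderiv_le z hz v := hg.enorm_fderiv_ramp_mul_ramp_le hδ hA hz v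

end IsRegularizedDistance

theorem exists_isInteriorCutoff [FiniteDimensional ℝ E] (Ω : Set E) :
    ∃ A : NNReal, ∀ δ > 0, ∃ κ, IsInteriorCutoff Ω A δ κ := by
  obtain ⟨A, hA⟩ := exists_enorm_deriv_ramp_le
  refine ⟨A, fun δ hδ => ?_⟩
  obtain ⟨g, hg⟩ := exists_isRegularizedDistance Ω hδ
  exact ⟨_, hg.isInteriorCutoff hδ (hA δ hδ)⟩

end Cutoff

section DivergenceMeasureField

theorem integrable_fderiv_apply {E : Type*} [NormedAddCommGroup E] [NormedSpace ℝ E]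
    [MeasurableSpace E] [OpensMeasurableSpace E] {μ : Measure E} [IsFiniteMeasureOnCompacts μ]
    {φ : E → ℝ} (hφ : ContDiff ℝ 1 φ) (hφc : HasCompactSupport φ) {B : E → E}
    (hB : MemLp B ∞ μ) : Integrable (fun z => fderiv ℝ φ z (B z)) μ :=
  memLp_one_iff_integrable.1 <| (ContinuousLinearMap.id ℝ (E →L[ℝ] ℝ)).memLp_of_bilin 1
    ((hφ.continuous_fderiv one_ne_zero).memLp_of_hasCompactSupport (p := 1) (hφc.fderiv ℝ)) hB

variable {d : ℕ} {Ω : Set (EuclideanSpace ℝ (Fin d))} {T : ℝ}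

theorem measurableSet_spaceTimeCylinder (hΩ : IsOpen Ω) :
    MeasurableSet (spaceTimeCylinder T Ω) :=
  measurableSet_Ioo.prod hΩ.measurableSet

namespace IsTestFunctionUpToZero

variable {φ : ℝ × EuclideanSpace ℝ (Fin d) → ℝ}

theorem integrable (hφ : IsTestFunctionUpToZero T φ)
    (μ : Measure (ℝ × EuclideanSpace ℝ (Fin d))) [IsFiniteMeasureOnCompacts μ] : Integrable φ μ :=
  hφ.1.continuous.integrable_of_hasCompactSupport hφ.2.1

theorem integrableOn (hφ : IsTestFunctionUpToZero T φ) (hΩ : IsOpen Ω)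
    {μ : Measure (ℝ × EuclideanSpace ℝ (Fin d))} (hμ : LocallyFiniteUpToBoundary T Ω μ) :
    IntegrableOn φ (spaceTimeCylinder T Ω) μ := by
  let K : Set (ℝ × EuclideanSpace ℝ (Fin d)) := tsupport φ ∩ Ici 0 ×ˢ closure Ω
  have hK : IsCompact K := hφ.2.1.isCompact.inter_right (isClosed_Ici.prod isClosed_closure)
  have hμK := hμ K hK fun z hz => ⟨⟨hz.2.1, (hφ.2.2 hz.1).1⟩, hz.2.2⟩
  obtain ⟨A, hA⟩ := hφ.2.1.exists_bound_of_continuous hφ.1.continuous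
  refine IntegrableOn.integrable_of_ae_notMem_eq_zero (s := K)
    (.of_bound hμK hφ.1.continuous.aestronglyMeasurable A (.of_forall hA)) ?_
  filter_upwards [ae_restrict_mem (measurableSet_spaceTimeCylinder hΩ)] with z hz hzK
  by_contra hne
  exact hzK ⟨subset_tsupport φ hne, hz.1.1.le, subset_closure hz.2⟩

end IsTestFunctionUpToZero

/-- The weak form, tested with `φ`, of the space-time divergence on `]0, T[ × Ω` of the field `B`,
with its time and space components, against the source `μp - μn`. -/
noncomputable def fluxPairing (T : ℝ) (Ω : Set (EuclideanSpace ℝ (Fin d)))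
    (B : ℝ × EuclideanSpace ℝ (Fin d) → ℝ × EuclideanSpace ℝ (Fin d))
    (μp μn : Measure (ℝ × EuclideanSpace ℝ (Fin d)))
    (φ : ℝ × EuclideanSpace ℝ (Fin d) → ℝ) : ℝ :=
  (∫ z in spaceTimeCylinder T Ω, fderiv ℝ φ z (B z))
    + ((∫ z in spaceTimeCylinder T Ω, φ z ∂μp) - ∫ z in spaceTimeCylinder T Ω, φ z ∂μn)

/-- The bounded space-time field `B` on `]0, T[ × Ω` has the distributional divergence `μp - μn`,
where `μp` and `μn` are locally finite up to `t = 0` and up to `∂Ω`. -/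
structure IsDivergenceMeasureField (T : ℝ) (Ω : Set (EuclideanSpace ℝ (Fin d)))
    (B : ℝ × EuclideanSpace ℝ (Fin d) → ℝ × EuclideanSpace ℝ (Fin d))
    (μp μn : Measure (ℝ × EuclideanSpace ℝ (Fin d))) : Prop where
  memLp : MemLp B ∞ (volume.restrict (spaceTimeCylinder T Ω))
  locallyFinite_pos : LocallyFiniteUpToBoundary T Ω μp
  locallyFinite_neg : LocallyFiniteUpToBoundary T Ω μn
  fluxPairing_eq_zero : ∀ η, IsTestFunction (spaceTimeCylinder T Ω) η →
    fluxPairing T Ω B μp μn η = 0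

namespace IsInteriorCutoff

variable {A : NNReal} {δ : ℝ}

theorem isTestFunction_mul {κ : ℝ × EuclideanSpace ℝ (Fin d) → ℝ}
    (hκ : IsInteriorCutoff Ω A δ κ) {φ : ℝ × EuclideanSpace ℝ (Fin d) → ℝ}
    (hφ : IsTestFunctionUpToZero T φ) :
    IsTestFunction (spaceTimeCylinder T Ω) fun z => κ z * φ z :=
  ⟨hκ.contDiff.mul hφ.1, hφ.2.1.mul_left, fun _ hz =>
    have hzκ := hκ.tsupport_subset (tsupport_mul_subset_left hz)
    ⟨⟨hzκ.1, (hφ.2.2 (tsupport_mul_subset_right hz)).1⟩, hzκ.2⟩⟩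

theorem tendsto_integral_mul (hΩ : IsOpen Ω) {κ : ℝ → ℝ × EuclideanSpace ℝ (Fin d) → ℝ}
    (hκ : ∀ δ > 0, IsInteriorCutoff Ω A δ (κ δ)) {μ : Measure (ℝ × EuclideanSpace ℝ (Fin d))}
    {F : ℝ × EuclideanSpace ℝ (Fin d) → ℝ} (hF : IntegrableOn F (spaceTimeCylinder T Ω) μ) :
    Tendsto (fun δ => ∫ z in spaceTimeCylinder T Ω, κ δ z * F z ∂μ) (𝓝[>] 0)
      (𝓝 (∫ z in spaceTimeCylinder T Ω, F z ∂μ)) := by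
  have hpos : ∀ᶠ δ : ℝ in 𝓝[>] 0, 0 < δ := eventually_mem_nhdsWithin
  refine tendsto_integral_filter_of_dominated_convergence (fun z => ‖F z‖) ?_ ?_ hF.norm ?_
  · filter_upwards [hpos] with δ hδ
    exact (hκ δ hδ).contDiff.continuous.aestronglyMeasurable.mul hF.1
  · filter_upwards [hpos] with δ hδ
    refine .of_forall fun z => ?_
    rw [norm_mul, Real.norm_of_nonneg ((hκ δ hδ).mem_Icc z).1]
    exact mul_le_of_le_one_left (norm_nonneg _) ((hκ δ hδ).mem_Icc z).2
  · filter_upwards [ae_restrict_mem (measurableSet_spaceTimeCylinder hΩ)] with z hz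
    have hzF : z.2 ∉ closure (frontier Ω) := by
      rw [isClosed_frontier.closure_eq, hΩ.frontier_eq]
      exact fun h => h.2 hz.2
    refine tendsto_const_nhds.congr' ?_
    filter_upwards [hpos, nhdsWithin_le_nhds (Iio_mem_nhds hz.1.1),
      nhdsWithin_le_nhds (eventually_notMem_thickening_of_infEDist_pos hzF)] with δ hδ hδz hzδ
    rw [(hκ δ hδ).eq_one z ⟨hδz, hz.2, hzδ⟩, one_mul]

theorem fluxPairing_mul {κ : ℝ × EuclideanSpace ℝ (Fin d) → ℝ}
    (hκ : IsInteriorCutoff Ω A δ κ)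
    {B : ℝ × EuclideanSpace ℝ (Fin d) → ℝ × EuclideanSpace ℝ (Fin d)}
    (hB : MemLp B ∞ (volume.restrict (spaceTimeCylinder T Ω)))
    (μp μn : Measure (ℝ × EuclideanSpace ℝ (Fin d)))
    {φ : ℝ × EuclideanSpace ℝ (Fin d) → ℝ} (hφ : IsTestFunctionUpToZero T φ) :
    fluxPairing T Ω B μp μn (fun z => κ z * φ z) =
      (∫ z in spaceTimeCylinder T Ω, κ z * fderiv ℝ φ z (B z))
        + ((∫ z in spaceTimeCylinder T Ω, κ z * φ z ∂μp)
          - ∫ z in spaceTimeCylinder T Ω, κ z * φ z ∂μn)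
        + ∫ z in spaceTimeCylinder T Ω, φ z * fderiv ℝ κ z (B z) := by
  have hfderiv (z) : fderiv ℝ (fun z => κ z * φ z) z (B z)
      = κ z * fderiv ℝ φ z (B z) + φ z * fderiv ℝ κ z (B z) := by
    rw [fderiv_fun_mul (hκ.contDiff.differentiable (by simp) z)
      (hφ.1.differentiable (by simp) z)]
    simp
  have hint : IntegrableOn (fun z => κ z * fderiv ℝ φ z (B z)) (spaceTimeCylinder T Ω) := by
    refine (integrable_fderiv_apply (hφ.1.of_le (by simp)) hφ.2.1 hB).bdd_mul (c := 1)
      hκ.contDiff.continuous.aestronglyMeasurable (.of_forall fun z => ?_)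
    rw [Real.norm_of_nonneg (hκ.mem_Icc z).1]
    exact (hκ.mem_Icc z).2
  have hint' : IntegrableOn (fun z => φ z * fderiv ℝ κ z (B z)) (spaceTimeCylinder T Ω) := by
    have hκφ := hκ.isTestFunction_mul hφ
    refine ((integrable_fderiv_apply (hκφ.1.of_le (by simp)) hκφ.2.1 hB).sub hint).congr
      (.of_forall fun z => ?_)
    simp only [Pi.sub_apply, hfderiv, add_sub_cancel_left]
  simp only [fluxPairing, hfderiv]
  rw [integral_add hint hint']
  ring

theorem ae_enorm_fderiv_apply_le (hΩ : IsOpen Ω) {κ : ℝ × EuclideanSpace ℝ (Fin d) → ℝ}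
    (hκ : IsInteriorCutoff Ω A δ κ)
    (B : ℝ × EuclideanSpace ℝ (Fin d) → ℝ × EuclideanSpace ℝ (Fin d)) :
    ∀ᵐ z ∂volume.restrict (spaceTimeCylinder T Ω), ‖fderiv ℝ κ z (B z)‖ₑ ≤
      A / ENNReal.ofReal δ *
        (eLpNorm (fun z => (B z).1) ∞ (volume.restrict (spaceTimeCylinder T Ω)) *
            (Ioc 0 δ ×ˢ Ω).indicator 1 z
          + eLpNorm (fun z => (B z).2) ∞ (volume.restrict (spaceTimeCylinder T Ω)) *
            (Ioo 0 T ×ˢ (Ω ∩ thickening δ (frontier Ω))).indicator 1 z) := by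
  simp only [eLpNorm_exponent_top]
  filter_upwards [enorm_ae_le_eLpNormEssSup (fun z => (B z).1) _,
    enorm_ae_le_eLpNormEssSup (fun z => (B z).2) _,
    ae_restrict_mem (measurableSet_spaceTimeCylinder hΩ)] with z hB₁ hB₂ hz
  refine (hκ.enorm_fderiv_le z hz.2 _).trans ?_
  gcongr
  · by_cases ht : z.1 ≤ δ
    · have hzS : z ∈ Ioc 0 δ ×ˢ Ω := ⟨⟨hz.1.1, ht⟩, hz.2⟩
      simpa [indicator_of_mem (mem_Iic.2 ht), indicator_of_mem hzS] using hB₁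
    · simp [ht]
  · by_cases hx : z.2 ∈ thickening δ (frontier Ω)
    · have hzS : z ∈ Ioo 0 T ×ˢ (Ω ∩ thickening δ (frontier Ω)) := ⟨hz.1, hz.2, hx⟩
      simpa [indicator_of_mem hx, indicator_of_mem hzS] using hB₂
    · simp [hx]

theorem enorm_integral_mul_fderiv_le (hΩ : IsOpen Ω) {κ : ℝ × EuclideanSpace ℝ (Fin d) → ℝ}
    (hκ : IsInteriorCutoff Ω A δ κ)
    (B : ℝ × EuclideanSpace ℝ (Fin d) → ℝ × EuclideanSpace ℝ (Fin d))
    {φ : ℝ × EuclideanSpace ℝ (Fin d) → ℝ} (hφ : Measurable φ) :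
    ‖∫ z in spaceTimeCylinder T Ω, φ z * fderiv ℝ κ z (B z)‖ₑ ≤
      A / ENNReal.ofReal δ *
        (eLpNorm (fun z => (B z).1) ∞ (volume.restrict (spaceTimeCylinder T Ω)) *
            (∫⁻ z in Ioc 0 δ ×ˢ Ω, ‖φ z‖ₑ)
          + eLpNorm (fun z => (B z).2) ∞ (volume.restrict (spaceTimeCylinder T Ω)) *
            ∫⁻ z in Ioo 0 T ×ˢ (Ω ∩ thickening δ (frontier Ω)), ‖φ z‖ₑ) := by
  set N₁ := eLpNorm (fun z => (B z).1) ∞ (volume.restrict (spaceTimeCylinder T Ω))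
  set N₂ := eLpNorm (fun z => (B z).2) ∞ (volume.restrict (spaceTimeCylinder T Ω))
  set S₁ : Set (ℝ × EuclideanSpace ℝ (Fin d)) := Ioc 0 δ ×ˢ Ω
  set S₂ : Set (ℝ × EuclideanSpace ℝ (Fin d)) := Ioo 0 T ×ˢ (Ω ∩ thickening δ (frontier Ω))
  have hS₁ : MeasurableSet S₁ := measurableSet_Ioc.prod hΩ.measurableSet
  have hS₂ : MeasurableSet S₂ := measurableSet_Ioo.prod (hΩ.inter isOpen_thickening).measurableSet
  have hm₁ : Measurable (S₁.indicator fun z => ‖φ z‖ₑ) := hφ.enorm.indicator hS₁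
  have hm₂ : Measurable (S₂.indicator fun z => ‖φ z‖ₑ) := hφ.enorm.indicator hS₂
  have hφS (S : Set (ℝ × EuclideanSpace ℝ (Fin d))) (z : ℝ × EuclideanSpace ℝ (Fin d)) :
      S.indicator (fun z => ‖φ z‖ₑ) z = ‖φ z‖ₑ * S.indicator 1 z := by
    by_cases hz : z ∈ S <;> simp [hz]
  calc ‖∫ z in spaceTimeCylinder T Ω, φ z * fderiv ℝ κ z (B z)‖ₑ
      ≤ ∫⁻ z in spaceTimeCylinder T Ω, ‖φ z * fderiv ℝ κ z (B z)‖ₑ :=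
        enorm_integral_le_lintegral_enorm _
    _ ≤ ∫⁻ z in spaceTimeCylinder T Ω, A / ENNReal.ofReal δ *
          (N₁ * S₁.indicator (fun z => ‖φ z‖ₑ) z + N₂ * S₂.indicator (fun z => ‖φ z‖ₑ) z) := by
        refine lintegral_mono_ae ?_
        filter_upwards [hκ.ae_enorm_fderiv_apply_le (T := T) hΩ B] with z hz
        rw [enorm_mul, hφS, hφS, mul_left_comm N₁, mul_left_comm N₂, ← mul_add, mul_left_comm]
        gcongr
    _ ≤ ∫⁻ z, A / ENNReal.ofReal δ *
          (N₁ * S₁.indicator (fun z => ‖φ z‖ₑ) z + N₂ * S₂.indicator (fun z => ‖φ z‖ₑ) z) :=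
        setLIntegral_le_lintegral _ _
    _ = _ := by
        rw [lintegral_const_mul _ (by fun_prop), lintegral_add_left (hm₁.const_mul _),
          lintegral_const_mul _ hm₁, lintegral_const_mul _ hm₂, lintegral_indicator hS₁,
          lintegral_indicator hS₂]

end IsInteriorCutoff

namespace IsDivergenceMeasureField

variable {B : ℝ × EuclideanSpace ℝ (Fin d) → ℝ × EuclideanSpace ℝ (Fin d)}
  {μp μn : Measure (ℝ × EuclideanSpace ℝ (Fin d))} {φ : ℝ × EuclideanSpace ℝ (Fin d) → ℝ}

theorem tendsto_integral_mul_fderiv_cutoff (hB : IsDivergenceMeasureField T Ω B μp μn)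
    (hΩ : IsOpen Ω) {A : NNReal} {κ : ℝ → ℝ × EuclideanSpace ℝ (Fin d) → ℝ}
    (hκ : ∀ δ > 0, IsInteriorCutoff Ω A δ (κ δ)) (hφ : IsTestFunctionUpToZero T φ) :
    Tendsto (fun δ => ∫ z in spaceTimeCylinder T Ω, φ z * fderiv ℝ (κ δ) z (B z)) (𝓝[>] 0)
      (𝓝 (-fluxPairing T Ω B μp μn φ)) := by
  have hint : IntegrableOn (fun z => fderiv ℝ φ z (B z)) (spaceTimeCylinder T Ω) :=
    integrable_fderiv_apply (hφ.1.of_le (by simp)) hφ.2.1 hB.memLp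
  have hlim := (IsInteriorCutoff.tendsto_integral_mul hΩ hκ hint).add
    ((IsInteriorCutoff.tendsto_integral_mul hΩ hκ (hφ.integrableOn hΩ hB.locallyFinite_pos)).sub
      (IsInteriorCutoff.tendsto_integral_mul hΩ hκ (hφ.integrableOn hΩ hB.locallyFinite_neg)))
  refine hlim.neg.congr' ?_
  filter_upwards [eventually_mem_nhdsWithin] with δ hδ
  have hzero := hB.fluxPairing_eq_zero _ ((hκ δ hδ).isTestFunction_mul hφ)
  rw [(hκ δ hδ).fluxPairing_mul hB.memLp μp μn hφ] at hzero
  exact (eq_neg_of_add_eq_zero_right hzero).symm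

theorem enorm_fluxPairing_le_upperDini (hB : IsDivergenceMeasureField T Ω B μp μn)
    (hΩ : IsOpen Ω) {A : NNReal} {κ : ℝ → ℝ × EuclideanSpace ℝ (Fin d) → ℝ}
    (hκ : ∀ δ > 0, IsInteriorCutoff Ω A δ (κ δ)) (hφ : IsTestFunctionUpToZero T φ) :
    ‖fluxPairing T Ω B μp μn φ‖ₑ ≤
      A * (eLpNorm (fun z => (B z).1) ∞ (volume.restrict (spaceTimeCylinder T Ω)) *
          upperDini (fun δ => ∫⁻ z in Ioc 0 δ ×ˢ Ω, ‖φ z‖ₑ)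
        + eLpNorm (fun z => (B z).2) ∞ (volume.restrict (spaceTimeCylinder T Ω)) *
          upperDini (fun δ => ∫⁻ z in Ioo 0 T ×ˢ (Ω ∩ thickening δ (frontier Ω)), ‖φ z‖ₑ)) := by
  have hlim := (hB.tendsto_integral_mul_fderiv_cutoff hΩ hκ hφ).enorm
  rw [enorm_neg] at hlim
  rw [← hlim.limsup_eq]
  calc _ ≤ upperDini (fun δ => A *
          (eLpNorm (fun z => (B z).1) ∞ (volume.restrict (spaceTimeCylinder T Ω)) *
            (∫⁻ z in Ioc 0 δ ×ˢ Ω, ‖φ z‖ₑ)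
          + eLpNorm (fun z => (B z).2) ∞ (volume.restrict (spaceTimeCylinder T Ω)) *
            ∫⁻ z in Ioo 0 T ×ˢ (Ω ∩ thickening δ (frontier Ω)), ‖φ z‖ₑ)) := by
        refine limsup_le_limsup ?_
        filter_upwards [eventually_mem_nhdsWithin] with δ hδ
        refine ((hκ δ hδ).enorm_integral_mul_fderiv_le hΩ B hφ.1.continuous.measurable).trans_eq ?_
        simp only [div_eq_mul_inv]
        exact mul_right_comm _ _ _
    _ ≤ _ := by
        rw [upperDini_const_mul ENNReal.coe_ne_top,
          ← upperDini_const_mul hB.memLp.fst.eLpNorm_ne_top,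
          ← upperDini_const_mul hB.memLp.snd.eLpNorm_ne_top]
        gcongr
        exact upperDini_add_le

theorem exists_enorm_fluxPairing_le (hΩ : IsOpen Ω) (𝒜 : LipschitzAtlas Ω)
    (hB : IsDivergenceMeasureField T Ω B μp μn) :
    ∃ C : NNReal, ∀ φ, IsTestFunctionUpToZero T φ → ‖fluxPairing T Ω B μp μn φ‖ₑ ≤
      C * (eLpNorm (fun z => (B z).1) ∞ (volume.restrict (spaceTimeCylinder T Ω)) *
          (∫⁻ z, ‖φ z‖ₑ ∂initialMeasure Ω)
        + eLpNorm (fun z => (B z).2) ∞ (volume.restrict (spaceTimeCylinder T Ω)) *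
          ∫⁻ z, ‖φ z‖ₑ ∂lateralMeasure T Ω) := by
  obtain ⟨A, hA⟩ := exists_isInteriorCutoff Ω
  choose! κ hκ using hA
  let c : NNReal := Real.toNNReal (1 + 𝒜.lipschitzConst) * 𝒜.multiplicity
  refine ⟨A * max 1 c, fun φ hφ => (hB.enorm_fluxPairing_le_upperDini hΩ hκ hφ).trans ?_⟩
  rw [ENNReal.coe_mul, mul_assoc, mul_add (ENNReal.ofNNReal (max 1 c)),
    mul_left_comm _ (eLpNorm _ _ _), mul_left_comm _ (eLpNorm _ _ _)]
  gcongr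
  · exact (upperDini_lintegral_Ioc_prod_le Ω hφ.1.continuous hφ.2.1).trans
      (le_mul_of_one_le_left' (ENNReal.one_le_coe_iff.2 (le_max_left _ _)))
  · calc _ ≤ ENNReal.ofReal (1 + 𝒜.lipschitzConst) *
          (𝒜.multiplicity * ∫⁻ z, ‖φ z‖ₑ ∂lateralMeasure T Ω) :=
        𝒜.upperDini_lintegral_layer_le T hφ.1.continuous hφ.2.1
      _ = c * ∫⁻ z, ‖φ z‖ₑ ∂lateralMeasure T Ω := by
        rw [← mul_assoc, ENNReal.coe_mul, ENNReal.coe_natCast, ENNReal.ofReal]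
      _ ≤ _ := by
        gcongr
        exact le_max_right _ _

end IsDivergenceMeasureField

end DivergenceMeasureField

section BoundaryDensity

variable {d : ℕ} {Ω : Set (EuclideanSpace ℝ (Fin d))} {T : ℝ}
  {B : ℝ × EuclideanSpace ℝ (Fin d) → ℝ × EuclideanSpace ℝ (Fin d)}
  {μp μn : Measure (ℝ × EuclideanSpace ℝ (Fin d))} {φ ψ : ℝ × EuclideanSpace ℝ (Fin d) → ℝ}

/-- The space `C_c^∞([0, T[ × ℝᵈ)`, the domain of the functionals represented by traces. -/
def testFunctionsUpToZero (d : ℕ) (T : ℝ) :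
    Submodule ℝ (ℝ × EuclideanSpace ℝ (Fin d) → ℝ) where
  carrier := {φ | IsTestFunctionUpToZero T φ}
  zero_mem' := ⟨contDiff_const, HasCompactSupport.zero, by simp⟩
  add_mem' := fun {φ ψ} hφ hψ => ⟨hφ.1.add hψ.1, hφ.2.1.add hψ.2.1,
    (tsupport_add φ ψ).trans (union_subset hφ.2.2 hψ.2.2)⟩
  smul_mem' := fun c φ hφ => ⟨contDiff_const.smul hφ.1, hφ.2.1.smul_left,
    (closure_mono (Function.support_const_smul_subset c φ)).trans hφ.2.2⟩

theorem fluxPairing_smul (B : ℝ × EuclideanSpace ℝ (Fin d) → ℝ × EuclideanSpace ℝ (Fin d))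
    (μp μn : Measure (ℝ × EuclideanSpace ℝ (Fin d))) (c : ℝ) (hφ : Differentiable ℝ φ) :
    fluxPairing T Ω B μp μn (c • φ) = c * fluxPairing T Ω B μp μn φ := by
  simp only [fluxPairing, fderiv_const_smul (hφ _), smul_apply, Pi.smul_apply,
    smul_eq_mul, integral_const_mul]
  ring

namespace IsDivergenceMeasureField

theorem fluxPairing_add (hB : IsDivergenceMeasureField T Ω B μp μn) (hΩ : IsOpen Ω)
    (hφ : IsTestFunctionUpToZero T φ) (hψ : IsTestFunctionUpToZero T ψ) :
    fluxPairing T Ω B μp μn (φ + ψ) =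
      fluxPairing T Ω B μp μn φ + fluxPairing T Ω B μp μn ψ := by
  have hadd (z) : fderiv ℝ (φ + ψ) z (B z) = fderiv ℝ φ z (B z) + fderiv ℝ ψ z (B z) := by
    rw [fderiv_add (hφ.1.differentiable (by simp) z) (hψ.1.differentiable (by simp) z),
      add_apply]
  simp only [fluxPairing, hadd, Pi.add_apply]
  rw [integral_add (integrable_fderiv_apply (hφ.1.of_le (by simp)) hφ.2.1 hB.memLp)
      (integrable_fderiv_apply (hψ.1.of_le (by simp)) hψ.2.1 hB.memLp),
    integral_add (hφ.integrableOn hΩ hB.locallyFinite_pos)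
      (hψ.integrableOn hΩ hB.locallyFinite_pos),
    integral_add (hφ.integrableOn hΩ hB.locallyFinite_neg)
      (hψ.integrableOn hΩ hB.locallyFinite_neg)]
  ring

theorem exists_boundaryDensity (hB : IsDivergenceMeasureField T Ω B μp μn) (hΩ : IsOpen Ω)
    (ν : Measure (ℝ × EuclideanSpace ℝ (Fin d))) [SigmaFinite ν] [IsFiniteMeasureOnCompacts ν]
    {C : ℝ≥0∞} (hC : C ≠ ∞) (hle : ∀ φ, IsTestFunctionUpToZero T φ →
      ‖fluxPairing T Ω B μp μn φ‖ₑ ≤ C * ∫⁻ z, ‖φ z‖ₑ ∂ν) :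
    ∃ G : Lp ℝ ∞ ν, ∀ φ, IsTestFunctionUpToZero T φ →
      ∫ z, G z * φ z ∂ν = fluxPairing T Ω B μp μn φ := by
  let ι : testFunctionsUpToZero d T →ₗ[ℝ] Lp ℝ 1 ν :=
    { toFun := fun φ => (IsTestFunctionUpToZero.integrable φ.2 ν).toL1 _
      map_add' := fun φ ψ => Integrable.toL1_add _ _ _ _
      map_smul' := fun c φ => Integrable.toL1_smul φ.1 (IsTestFunctionUpToZero.integrable φ.2 ν) c }
  let Λ : testFunctionsUpToZero d T →ₗ[ℝ] ℝ :=
    { toFun := fun φ => fluxPairing T Ω B μp μn φ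
      map_add' := fun φ ψ => hB.fluxPairing_add hΩ φ.2 ψ.2
      map_smul' := fun c φ => fluxPairing_smul B μp μn c (φ.2.1.differentiable (by simp)) }
  have hΛ (φ) : |Λ φ| ≤ C.toReal * ‖ι φ‖ := by
    have hι : ‖ι φ‖ₑ = ∫⁻ z, ‖φ.1 z‖ₑ ∂ν :=
      Integrable.enorm_toL1 (IsTestFunctionUpToZero.integrable φ.2 ν)
    have hΛ := hle φ φ.2
    rw [← hι] at hΛ
    have hreal := ENNReal.toReal_mono (ENNReal.mul_ne_top hC enorm_ne_top) hΛ
    rwa [ENNReal.toReal_mul, toReal_enorm, toReal_enorm] at hreal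
  obtain ⟨G, hG⟩ := exists_Lp_top_apply_eq_integral_of_le ν ι Λ _ hΛ
  refine ⟨G, fun φ hφ => .trans (integral_congr_ae ?_) (hG ⟨φ, hφ⟩).symm⟩
  filter_upwards [(hφ.integrable ν).coeFn_toL1] with z hz
  rw [← hz]
  rfl

end IsDivergenceMeasureField

end BoundaryDensity

section Trace

variable {d : ℕ} {Ω : Set (EuclideanSpace ℝ (Fin d))} {T : ℝ}

/-- The left-hand side of the trace identity: `u` is the trace on `]0, T[ × ∂Ω` and `v` the
initial trace, which enters with the sign of the outer normal at `t = 0`. -/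
noncomputable def boundaryPairing (T : ℝ) (Ω : Set (EuclideanSpace ℝ (Fin d)))
    (u : ℝ × EuclideanSpace ℝ (Fin d) → ℝ) (v : EuclideanSpace ℝ (Fin d) → ℝ)
    (φ : ℝ × EuclideanSpace ℝ (Fin d) → ℝ) : ℝ :=
  (∫ z, u z * φ z ∂lateralMeasure T Ω) - ∫ x in Ω, φ (0, x) * v x

theorem initialMeasure_eq_map (Ω : Set (EuclideanSpace ℝ (Fin d))) :
    initialMeasure Ω = (volume.restrict Ω).map (Prod.mk 0) :=
  Measure.dirac_prod 0

instance (Ω : Set (EuclideanSpace ℝ (Fin d))) : IsLocallyFiniteMeasure (initialMeasure Ω) := by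
  rw [initialMeasure]
  infer_instance

theorem integral_initialMeasure (Ω : Set (EuclideanSpace ℝ (Fin d)))
    (F : ℝ × EuclideanSpace ℝ (Fin d) → ℝ) :
    ∫ z, F z ∂initialMeasure Ω = ∫ x in Ω, F (0, x) := by
  rw [initialMeasure_eq_map, (measurableEmbedding_prodMk_left 0).integral_map]

theorem ae_initialMeasure_iff {p : ℝ × EuclideanSpace ℝ (Fin d) → Prop} :
    (∀ᵐ z ∂initialMeasure Ω, p z) ↔ ∀ᵐ x ∂volume.restrict Ω, p (0, x) := by
  rw [initialMeasure_eq_map, (measurableEmbedding_prodMk_left 0).ae_map_iff]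

theorem memLp_initialMeasure_iff {F : ℝ × EuclideanSpace ℝ (Fin d) → ℝ} {p : ℝ≥0∞} :
    MemLp F p (initialMeasure Ω) ↔ MemLp (fun x => F (0, x)) p (volume.restrict Ω) := by
  rw [initialMeasure_eq_map, (measurableEmbedding_prodMk_left 0).memLp_map_measure_iff]
  rfl

theorem ae_eq_of_forall_isTestFunction_integral_mul_eq {V : Set (ℝ × EuclideanSpace ℝ (Fin d))}
    (hV : IsOpen V) {ν : Measure (ℝ × EuclideanSpace ℝ (Fin d))} (hνV : ∀ᵐ z ∂ν, z ∈ V)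
    {u u' : ℝ × EuclideanSpace ℝ (Fin d) → ℝ} (hu : LocallyIntegrable u ν)
    (hu' : LocallyIntegrable u' ν)
    (h : ∀ φ, IsTestFunction V φ → ∫ z, u z * φ z ∂ν = ∫ z, u' z * φ z ∂ν) : u =ᵐ[ν] u' := by
  have hzero := hV.ae_eq_zero_of_integral_contDiff_smul_eq_zero
    ((hu.sub hu').locallyIntegrableOn V) fun φ hφ hφc hφV => by
      simp only [Pi.sub_apply, smul_sub]
      rw [integral_sub (hu.integrable_smul_left_of_hasCompactSupport hφ.continuous hφc)
        (hu'.integrable_smul_left_of_hasCompactSupport hφ.continuous hφc), sub_eq_zero]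
      simpa only [smul_eq_mul, mul_comm] using h φ ⟨hφ, hφc, hφV⟩
  filter_upwards [hνV, hzero] with z hz hz0 using sub_eq_zero.1 (hz0 hz)

theorem lateralTrace_unique [IsLocallyFiniteMeasure (lateralMeasure T Ω)]
    {u u' : Lp ℝ ∞ (lateralMeasure T Ω)}
    (h : ∀ φ, IsTestFunction (Ioo 0 T ×ˢ univ) φ →
      ∫ z, u z * φ z ∂lateralMeasure T Ω = ∫ z, u' z * φ z ∂lateralMeasure T Ω) : u = u' := by
  refine Lp.ext <| ae_eq_of_forall_isTestFunction_integral_mul_eq (isOpen_Ioo.prod isOpen_univ) ?_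
    ((Lp.memLp u).locallyIntegrable le_top) ((Lp.memLp u').locallyIntegrable le_top) h
  have hae : ∀ᵐ z ∂lateralMeasure T Ω, z.1 ∈ Ioo 0 T :=
    Measure.quasiMeasurePreserving_fst.ae (ae_restrict_mem measurableSet_Ioo)
  filter_upwards [hae] with z hz using ⟨hz, mem_univ _⟩

theorem traces_unique (hT : 0 < T) [IsLocallyFiniteMeasure (lateralMeasure T Ω)]
    {p q : Lp ℝ ∞ (lateralMeasure T Ω) × Lp ℝ ∞ (volume.restrict Ω)}
    (h : ∀ φ, IsTestFunctionUpToZero T φ →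
      boundaryPairing T Ω p.1 p.2 φ = boundaryPairing T Ω q.1 q.2 φ) : p = q := by
  have hlateral : p.1 = q.1 := lateralTrace_unique fun φ hφ => by
    have hφ₀ (x) : φ (0, x) = 0 := image_eq_zero_of_notMem_tsupport fun hx =>
      lt_irrefl 0 (hφ.2.2 hx).1.1
    simpa [boundaryPairing, hφ₀] using
      h φ ⟨hφ.1, hφ.2.1, hφ.2.2.trans (prod_mono_left Ioo_subset_Iio_self)⟩
  have hinitial (v : Lp ℝ ∞ (volume.restrict Ω)) :
      LocallyIntegrable (fun z : ℝ × EuclideanSpace ℝ (Fin d) => v z.2) (initialMeasure Ω) :=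
    (memLp_initialMeasure_iff.2 (Lp.memLp v)).locallyIntegrable le_top
  have hae : (fun z : ℝ × EuclideanSpace ℝ (Fin d) => p.2 z.2) =ᵐ[initialMeasure Ω]
      fun z => q.2 z.2 := by
    refine ae_eq_of_forall_isTestFunction_integral_mul_eq (isOpen_Iio.prod isOpen_univ)
      (ae_initialMeasure_iff.2 (.of_forall fun _ => ⟨hT, mem_univ _⟩)) (hinitial _) (hinitial _)
      fun φ hφ => ?_
    simp only [integral_initialMeasure, mul_comm _ (φ _)]
    simpa [boundaryPairing, hlateral] using h φ hφ
  exact Prod.ext hlateral (Lp.ext (ae_initialMeasure_iff.1 hae))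

namespace IsDivergenceMeasureField

variable {B : ℝ × EuclideanSpace ℝ (Fin d) → ℝ × EuclideanSpace ℝ (Fin d)}
  {μp μn : Measure (ℝ × EuclideanSpace ℝ (Fin d))}

theorem exists_traces (hB : IsDivergenceMeasureField T Ω B μp μn) (hΩ : IsOpen Ω)
    (𝒜 : LipschitzAtlas Ω) :
    ∃ p : Lp ℝ ∞ (lateralMeasure T Ω) × Lp ℝ ∞ (volume.restrict Ω),
      ∀ φ, IsTestFunctionUpToZero T φ →
        boundaryPairing T Ω p.1 p.2 φ = fluxPairing T Ω B μp μn φ := by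
  have := 𝒜.isLocallyFiniteMeasure_lateralMeasure T
  let ν := initialMeasure Ω + lateralMeasure T Ω
  have : IsFiniteMeasureOnCompacts ν :=
    ⟨fun K hK => ENNReal.add_lt_top.2 ⟨hK.measure_lt_top, hK.measure_lt_top⟩⟩
  obtain ⟨C, hC⟩ := hB.exists_enorm_fluxPairing_le hΩ 𝒜
  obtain ⟨G, hG⟩ := hB.exists_boundaryDensity hΩ ν
    (ENNReal.mul_ne_top ENNReal.coe_ne_top (max_lt hB.memLp.fst.2 hB.memLp.snd.2).ne)
    fun φ hφ => (hC φ hφ).trans <| by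
      rw [lintegral_add_measure, mul_assoc, mul_add (max _ _)]
      gcongr
      exacts [le_max_left _ _, le_max_right _ _]
  have hG₀ : MemLp G ∞ (initialMeasure Ω) :=
    (Lp.memLp G).mono_measure (Measure.le_add_right le_rfl)
  have hG₁ : MemLp G ∞ (lateralMeasure T Ω) :=
    (Lp.memLp G).mono_measure (Measure.le_add_left le_rfl)
  have hv : MemLp (fun x => -G (0, x)) ∞ (volume.restrict Ω) := (memLp_initialMeasure_iff.1 hG₀).neg
  refine ⟨(hG₁.toLp G, hv.toLp _), fun φ hφ => ?_⟩
  calc boundaryPairing T Ω (hG₁.toLp G) (hv.toLp _) φ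
      = (∫ z, G z * φ z ∂lateralMeasure T Ω) - ∫ x in Ω, φ (0, x) * -G (0, x) := by
        refine congrArg₂ _ (integral_congr_ae ?_) (integral_congr_ae ?_)
        · filter_upwards [hG₁.coeFn_toLp] with z hz
          rw [hz]
        · filter_upwards [hv.coeFn_toLp] with x hx
          rw [hx]
    _ = (∫ z, G z * φ z ∂initialMeasure Ω) + ∫ z, G z * φ z ∂lateralMeasure T Ω := by
        simp only [integral_initialMeasure, mul_neg, integral_neg, sub_neg_eq_add]
        rw [add_comm]
        simp only [mul_comm (φ _)]
    _ = fluxPairing T Ω B μp μn φ := by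
        rw [← hG φ hφ]
        exact (integral_add_measure ((hφ.integrable _).mul_of_top_right hG₀)
          ((hφ.integrable _).mul_of_top_right hG₁)).symm

theorem exists_lateralTrace (hB : IsDivergenceMeasureField T Ω B μp μn) (hΩ : IsOpen Ω)
    (𝒜 : LipschitzAtlas Ω) (hB₁ : ∀ z, (B z).1 = 0) :
    ∃ u : Lp ℝ ∞ (lateralMeasure T Ω), ∀ φ, IsTestFunctionUpToZero T φ →
      ∫ z, u z * φ z ∂lateralMeasure T Ω = fluxPairing T Ω B μp μn φ := by
  have := 𝒜.isLocallyFiniteMeasure_lateralMeasure T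
  obtain ⟨C, hC⟩ := hB.exists_enorm_fluxPairing_le hΩ 𝒜
  refine hB.exists_boundaryDensity hΩ _
    (ENNReal.mul_ne_top (ENNReal.coe_ne_top (r := C)) hB.memLp.snd.eLpNorm_ne_top) fun φ hφ => ?_
  have hfst : eLpNorm (fun z => (B z).1) ∞ (volume.restrict (spaceTimeCylinder T Ω)) = 0 := by
    simp only [hB₁]
    exact eLpNorm_zero'
  have := hC φ hφ
  rwa [hfst, zero_mul, zero_add, ← mul_assoc] at this

theorem existsUnique_lateralTrace (hB : IsDivergenceMeasureField T Ω B μp μn) (hΩ : IsOpen Ω)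
    (hLip : HasUniformlyLipschitzBoundary Ω) (hB₁ : ∀ z, (B z).1 = 0) :
    ∃! u : Lp ℝ ∞ (lateralMeasure T Ω), ∀ φ, IsTestFunctionUpToZero T φ →
      ∫ z, u z * φ z ∂lateralMeasure T Ω = fluxPairing T Ω B μp μn φ := by
  obtain ⟨𝒜⟩ := hLip.nonempty_lipschitzAtlas
  have := 𝒜.isLocallyFiniteMeasure_lateralMeasure T
  obtain ⟨u, hu⟩ := hB.exists_lateralTrace hΩ 𝒜 hB₁
  refine ⟨u, hu, fun u' hu' => lateralTrace_unique fun φ hφ => ?_⟩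
  have hφ' : IsTestFunctionUpToZero T φ :=
    ⟨hφ.1, hφ.2.1, hφ.2.2.trans (prod_mono_left Ioo_subset_Iio_self)⟩
  exact (hu' φ hφ').trans (hu φ hφ').symm

theorem existsUnique_traces (hB : IsDivergenceMeasureField T Ω B μp μn) (hΩ : IsOpen Ω)
    (hLip : HasUniformlyLipschitzBoundary Ω) (hT : 0 < T) :
    ∃! p : Lp ℝ ∞ (lateralMeasure T Ω) × Lp ℝ ∞ (volume.restrict Ω),
      ∀ φ, IsTestFunctionUpToZero T φ →
        boundaryPairing T Ω p.1 p.2 φ = fluxPairing T Ω B μp μn φ := by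
  obtain ⟨𝒜⟩ := hLip.nonempty_lipschitzAtlas
  have := 𝒜.isLocallyFiniteMeasure_lateralMeasure T
  obtain ⟨p, hp⟩ := hB.exists_traces hΩ 𝒜
  exact ⟨p, hp, fun q hq => traces_unique hT fun φ hφ => (hq φ hφ).trans (hp φ hφ).symm⟩

end IsDivergenceMeasureField

end Trace

section SpaceTimeField

variable {d : ℕ} {Ω : Set (EuclideanSpace ℝ (Fin d))} {T : ℝ}
  {b : ℝ × EuclideanSpace ℝ (Fin d) → EuclideanSpace ℝ (Fin d)}
  {φ : ℝ × EuclideanSpace ℝ (Fin d) → ℝ}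

theorem fderiv_prodMk_apply (φ : ℝ × EuclideanSpace ℝ (Fin d) → ℝ)
    (z : ℝ × EuclideanSpace ℝ (Fin d)) (w : ℝ) (v : EuclideanSpace ℝ (Fin d)) :
    fderiv ℝ φ z (w, w • v) = w * (timeDeriv φ z + spaceDeriv φ z v) := by
  rw [timeDeriv, spaceDeriv, ← map_add, ← smul_eq_mul, ← map_smul]
  simp

theorem IsTestFunctionUpToZero.integrable_timeDeriv (hφ : IsTestFunctionUpToZero T φ) :
    Integrable (timeDeriv φ) :=
  ((hφ.1.continuous_fderiv (by simp)).clm_apply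
    continuous_const).integrable_of_hasCompactSupport (hφ.2.1.fderiv_apply ℝ (1, 0))

theorem IsTestFunctionUpToZero.integral_timeDeriv (hT : 0 ≤ T)
    (hφ : IsTestFunctionUpToZero T φ) (x : EuclideanSpace ℝ (Fin d)) :
    ∫ t in Ioo 0 T, timeDeriv φ (t, x) = -φ (0, x) := by
  have hderiv (t : ℝ) : HasDerivAt (fun t => φ (t, x)) (timeDeriv φ (t, x)) t :=
    (hφ.1.differentiable (by simp) (t, x)).hasFDerivAt.comp_hasDerivAt t
      ((hasDerivAt_id t).prodMk (hasDerivAt_const t x))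
  have hcont : Continuous fun t => timeDeriv φ (t, x) :=
    ((hφ.1.continuous_fderiv (by simp)).clm_apply continuous_const).comp (.prodMk_left x)
  have hφT : φ (T, x) = 0 :=
    image_eq_zero_of_notMem_tsupport fun hx => lt_irrefl T (hφ.2.2 hx).1
  rw [← integral_Ioc_eq_integral_Ioo, ← intervalIntegral.integral_of_le hT,
    intervalIntegral.integral_eq_sub_of_hasDerivAt (fun t _ => hderiv t)
      (hcont.intervalIntegrable _ _), hφT, zero_sub]

theorem IsTestFunctionUpToZero.setIntegral_timeDeriv (hT : 0 ≤ T)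
    (hφ : IsTestFunctionUpToZero T φ) (Ω : Set (EuclideanSpace ℝ (Fin d))) :
    ∫ z in spaceTimeCylinder T Ω, timeDeriv φ z = -∫ x in Ω, φ (0, x) := by
  have hint := hφ.integrable_timeDeriv.restrict (s := spaceTimeCylinder T Ω)
  rw [spaceTimeCylinder, Measure.volume_eq_prod, ← Measure.prod_restrict] at hint ⊢
  rw [integral_prod_symm _ hint, ← integral_neg]
  exact integral_congr_ae (.of_forall (hφ.integral_timeDeriv hT))

theorem HasSpaceDivergence.isDivergenceMeasureField
    {μp μn : Measure (ℝ × EuclideanSpace ℝ (Fin d))} (hdiv : HasSpaceDivergence T Ω b μp μn)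
    (hb : MemLp b ∞ (volume.restrict (spaceTimeCylinder T Ω)))
    (hμp : LocallyFiniteUpToBoundary T Ω μp) (hμn : LocallyFiniteUpToBoundary T Ω μn) :
    IsDivergenceMeasureField T Ω (fun z => (0, b z)) μp μn where
  memLp := .of_fst_snd ⟨.zero, hb⟩
  locallyFinite_pos := hμp
  locallyFinite_neg := hμn
  fluxPairing_eq_zero η hη := by
    rw [fluxPairing, ← hdiv.2.2 η hη]
    exact add_neg_cancel _

theorem fluxPairing_zero_prodMk (hT : 0 ≤ T)
    (hb : MemLp b ∞ (volume.restrict (spaceTimeCylinder T Ω)))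
    (μp μn : Measure (ℝ × EuclideanSpace ℝ (Fin d))) (hφ : IsTestFunctionUpToZero T φ) :
    fluxPairing T Ω (fun z => (0, b z)) μp μn φ =
      (∫ z in spaceTimeCylinder T Ω, (timeDeriv φ z + spaceDeriv φ z (b z)))
        + ((∫ z in spaceTimeCylinder T Ω, φ z ∂μp) - ∫ z in spaceTimeCylinder T Ω, φ z ∂μn)
        + ∫ x in Ω, φ (0, x) := by
  have hspace : Integrable (fun z => spaceDeriv φ z (b z))
      (volume.restrict (spaceTimeCylinder T Ω)) :=
    integrable_fderiv_apply (hφ.1.of_le (by simp)) hφ.2.1 (.of_fst_snd ⟨.zero, hb⟩)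
  rw [integral_add hφ.integrable_timeDeriv.restrict hspace, hφ.setIntegral_timeDeriv hT,
    add_right_comm, neg_add_cancel_comm]
  rfl

theorem locallyFiniteUpToBoundary_withDensity_ofReal {f : ℝ × EuclideanSpace ℝ (Fin d) → ℝ}
    (hΩ : IsOpen Ω) (hf : LocallyIntegrable f (volume.restrict (spaceTimeCylinder T Ω))) :
    LocallyFiniteUpToBoundary T Ω (volume.withDensity fun z => ENNReal.ofReal (f z)) :=
  fun K hK _ => by
    rw [restrict_withDensity (measurableSet_spaceTimeCylinder hΩ),
      withDensity_apply _ hK.measurableSet]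
    exact (hf.integrableOn_isCompact hK).lintegral_lt_top

theorem setIntegral_withDensity_ofReal_sub {f φ : ℝ × EuclideanSpace ℝ (Fin d) → ℝ}
    (hΩ : IsOpen Ω) (hf : LocallyIntegrable f (volume.restrict (spaceTimeCylinder T Ω)))
    (hφ : IsTestFunctionUpToZero T φ) :
    (∫ z in spaceTimeCylinder T Ω, φ z ∂(volume.withDensity fun z => ENNReal.ofReal (f z)))
        - ∫ z in spaceTimeCylinder T Ω, φ z ∂(volume.withDensity fun z => ENNReal.ofReal (-f z)) =
    ∫ z in spaceTimeCylinder T Ω, f z * φ z := by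
  have hm := hf.aestronglyMeasurable.aemeasurable
  have hint (g) (hg : LocallyIntegrable g (volume.restrict (spaceTimeCylinder T Ω))) :
      IntegrableOn (fun z => max (g z) 0 * φ z) (spaceTimeCylinder T Ω) := by
    have hpos : LocallyIntegrable (fun z => max (g z) 0)
        (volume.restrict (spaceTimeCylinder T Ω)) :=
      hg.mono (hg.aestronglyMeasurable.sup aestronglyMeasurable_const)
        (.of_forall fun z => abs_max_le_max_abs_abs.trans (by simp))
    exact hpos.integrable_smul_right_of_hasCompactSupport hφ.1.continuous hφ.2.1
  simp only [restrict_withDensity (measurableSet_spaceTimeCylinder hΩ)]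
  rw [integral_withDensity_eq_integral_toReal_smul₀ hm.ennreal_ofReal (by simp),
    integral_withDensity_eq_integral_toReal_smul₀
      (f := fun z => ENNReal.ofReal (-f z)) hm.neg.ennreal_ofReal (by simp)]
  simp only [ENNReal.toReal_ofReal', smul_eq_mul]
  rw [← integral_sub (hint f hf) (hint (fun z => -f z) hf.neg)]
  simp only [← sub_mul, max_zero_sub_max_neg_zero_eq_self]

theorem fluxPairing_withDensity_ofReal {w f : ℝ × EuclideanSpace ℝ (Fin d) → ℝ} (hΩ : IsOpen Ω)
    (hf : LocallyIntegrable f (volume.restrict (spaceTimeCylinder T Ω)))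
    (hφ : IsTestFunctionUpToZero T φ) :
    fluxPairing T Ω (fun z => (w z, w z • b z)) (volume.withDensity fun z => ENNReal.ofReal (f z))
        (volume.withDensity fun z => ENNReal.ofReal (-f z)) φ =
      (∫ z in spaceTimeCylinder T Ω, w z * (timeDeriv φ z + spaceDeriv φ z (b z)))
        + ∫ z in spaceTimeCylinder T Ω, f z * φ z := by
  rw [fluxPairing, setIntegral_withDensity_ofReal_sub hΩ hf hφ]
  simp only [fderiv_prodMk_apply]

theorem IsDistributionalSolution.isDivergenceMeasureField
    {w f : ℝ × EuclideanSpace ℝ (Fin d) → ℝ} (hsol : IsDistributionalSolution T Ω b w f)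
    (hΩ : IsOpen Ω) (hw : MemLp w ∞ (volume.restrict (spaceTimeCylinder T Ω)))
    (hwb : MemLp (fun z => w z • b z) ∞ (volume.restrict (spaceTimeCylinder T Ω)))
    (hf : LocallyIntegrable f (volume.restrict (spaceTimeCylinder T Ω))) :
    IsDivergenceMeasureField T Ω (fun z => (w z, w z • b z))
      (volume.withDensity fun z => ENNReal.ofReal (f z))
      (volume.withDensity fun z => ENNReal.ofReal (-f z)) where
  memLp := .of_fst_snd ⟨hw, hwb⟩
  locallyFinite_pos := locallyFiniteUpToBoundary_withDensity_ofReal hΩ hf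
  locallyFinite_neg := locallyFiniteUpToBoundary_withDensity_ofReal hΩ hf.neg
  fluxPairing_eq_zero η hη := by
    have hη' : IsTestFunctionUpToZero T η :=
      ⟨hη.1, hη.2.1, hη.2.2.trans (prod_mono Ioo_subset_Iio_self (subset_univ _))⟩
    rw [fluxPairing_withDensity_ofReal hΩ hf hη']
    exact hsol η hη

end SpaceTimeField

theorem lemma3p3_general {d : ℕ} (Ω : Set (EuclideanSpace ℝ (Fin d))) (hΩ : IsOpen Ω)
    (hLip : HasUniformlyLipschitzBoundary Ω) (T : ℝ) (hT : 0 < T)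
    (b : ℝ × EuclideanSpace ℝ (Fin d) → EuclideanSpace ℝ (Fin d)) :
    (∀ μp μn : Measure (ℝ × EuclideanSpace ℝ (Fin d)),
      MemLp b ∞ (volume.restrict (spaceTimeCylinder T Ω)) → HasSpaceDivergence T Ω b μp μn →
      LocallyFiniteUpToBoundary T Ω μp → LocallyFiniteUpToBoundary T Ω μn →
      ∃! trb : Lp ℝ ∞ (lateralMeasure T Ω), ∀ φ, IsTestFunctionUpToZero T φ →
        (∫ z, trb z * φ z ∂(lateralMeasure T Ω)) - ∫ x in Ω, φ (0, x) =
          (∫ z in spaceTimeCylinder T Ω, (timeDeriv φ z + spaceDeriv φ z (b z)))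
            + ((∫ z in spaceTimeCylinder T Ω, φ z ∂μp)
              - ∫ z in spaceTimeCylinder T Ω, φ z ∂μn)) ∧
    ∀ w f : ℝ × EuclideanSpace ℝ (Fin d) → ℝ,
      MemLp w ∞ (volume.restrict (spaceTimeCylinder T Ω)) →
      MemLp (fun z => w z • b z) ∞ (volume.restrict (spaceTimeCylinder T Ω)) →
      LocallyIntegrable f (volume.restrict (spaceTimeCylinder T Ω)) →
      IsDistributionalSolution T Ω b w f →
      ∃! p : Lp ℝ ∞ (lateralMeasure T Ω) × Lp ℝ ∞ (volume.restrict Ω),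
        ∀ φ, IsTestFunctionUpToZero T φ →
          (∫ z, p.1 z * φ z ∂(lateralMeasure T Ω)) - ∫ x in Ω, φ (0, x) * p.2 x =
            (∫ z in spaceTimeCylinder T Ω, w z * (timeDeriv φ z + spaceDeriv φ z (b z)))
              + ∫ z in spaceTimeCylinder T Ω, f z * φ z := by
  refine ⟨fun μp μn hb hdiv hμp hμn => ?_, fun w f hw hwb hf hsol => ?_⟩
  · have hB := hdiv.isDivergenceMeasureField hb hμp hμn
    refine (existsUnique_congr fun u => forall₂_congr fun φ hφ => ?_).2
      (hB.existsUnique_lateralTrace hΩ hLip fun _ => rfl)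
    rw [fluxPairing_zero_prodMk hT.le hb μp μn hφ, sub_eq_iff_eq_add]
  · have hB := hsol.isDivergenceMeasureField hΩ hw hwb hf
    refine (existsUnique_congr fun p => forall₂_congr fun φ hφ => ?_).2
      (hB.existsUnique_traces hΩ hLip hT)
    rw [fluxPairing_withDensity_ofReal hΩ hf hφ, boundaryPairing]

theorem lemma3p3 {d : ℕ} (hd : 0 < d) (Ω : Set (EuclideanSpace ℝ (Fin d))) (hΩ : IsOpen Ω)
    (hLip : HasUniformlyLipschitzBoundary Ω) (T : ℝ) (hT : 0 < T)
    (b : ℝ × EuclideanSpace ℝ (Fin d) → EuclideanSpace ℝ (Fin d))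
    (hb : MemLp b ∞ (volume.restrict (spaceTimeCylinder T Ω)))
    (μp μn : Measure (ℝ × EuclideanSpace ℝ (Fin d)))
    (hdiv : HasSpaceDivergence T Ω b μp μn) :
    (LocallyFiniteUpToBoundary T Ω μp → LocallyFiniteUpToBoundary T Ω μn →
      ∃! trb : Lp ℝ ∞ (lateralMeasure T Ω), ∀ φ, IsTestFunctionUpToZero T φ →
        (∫ z, trb z * φ z ∂(lateralMeasure T Ω)) - ∫ x in Ω, φ (0, x) =
          (∫ z in spaceTimeCylinder T Ω, (timeDeriv φ z + spaceDeriv φ z (b z)))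
            + ((∫ z in spaceTimeCylinder T Ω, φ z ∂μp) - ∫ z in spaceTimeCylinder T Ω, φ z ∂μn)) ∧
    ∀ w f : ℝ × EuclideanSpace ℝ (Fin d) → ℝ,
      MemLp w ∞ (volume.restrict (spaceTimeCylinder T Ω)) →
      MemLp f ∞ (volume.restrict (spaceTimeCylinder T Ω)) →
      IsDistributionalSolution T Ω b w f →
      ∃! p : Lp ℝ ∞ (lateralMeasure T Ω) × Lp ℝ ∞ (volume.restrict Ω),
        ∀ φ, IsTestFunctionUpToZero T φ →
          (∫ z, p.1 z * φ z ∂(lateralMeasure T Ω)) - ∫ x in Ω, φ (0, x) * p.2 x =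
            (∫ z in spaceTimeCylinder T Ω, w z * (timeDeriv φ z + spaceDeriv φ z (b z)))
              + ∫ z in spaceTimeCylinder T Ω, f z * φ z := by
  obtain ⟨hTrace, hTraces⟩ := lemma3p3_general Ω hΩ hLip T hT b
  exact ⟨hTrace μp μn hb hdiv, fun w f hw hf =>
    hTraces w f hw (hb.smul hw) (hf.locallyIntegrable le_top)⟩
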